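/- Let $K$ be a field of characteristic $0$ and $m\ge 0$ an integer. **Definitions.** For a homogeneous ideal $I\subsetneq R=K[x_1,\dots,x_n]$ let $A=R/I$, with the grading induced by $\deg x_i=1$; its Hilbert function is $h_d(A)=\dim_K A_d$. An *O-sequence* is a sequence of natural numbers that is the Hilbert function of such an algebra, for some $n$ (so $h_0=1$); finite sequences are extended by zeros. A linear form $\ell$ is a *weak Lefschetz element* of $A$ if multiplication $\times\ell:A_d\to A_{d+1}$ is injective or surjective for every $d\ge 1$. An Artinian $A$ has *the WLP $m$ times* if there are linear forms $\ell_1,\dots,\ell_m$ such that $\ell_i$ is a weak Lefschetz element of $A/(\ell_1,\dots,\ell_{i-1})$ for $i=1,\dots,m$. For $h=(h_0,h_1,\dots)$ put $\Delta h=(h_0,\max(h_1-h_0,0),\max(h_2-h_1,0),\dots)$; if $h_0<h_1<\dots<h_k\ge h_{k+1}\ge\cdots$, this is $h_0,h_1-h_0,\dots,h_k-h_{k-1},0,0,\dots$. A *$0$-times weak Lefschetz O-sequence* is a finite O-sequence; for $m\ge1$, $h$ is an *$m$-times weak Lefschetz O-sequence* if it is a finite O-sequence, $h_0<h_1<\dots<h_k\ge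 h_{k+1}\ge\cdots$ for some $k$, and $\Delta h$ is an $(m-1)$-times weak Lefschetz O-sequence. Order monomials of equal degree with $x_1>\dots>x_n$: $u>v$ in the lex order if the first variable in which they differ has the larger exponent in $u$; $u>v$ in the rev-lex order if the last variable in which they differ has the smaller exponent in $u$. For an $m$-times weak Lefschetz O-sequence $h$ and $n=h_1$, the monomial ideal $\mathcal W_m(h)\subseteq K[x_1,\dots,x_n]$ is defined by induction on $m$. The ideal $\mathcal W_0(h)=\mathrm{Lex}(h)$ is generated by the largest $\dim_K R_d-h_d$ monomials of degree $d$ in the lex order, for all $d\ge0$. If $m\ge1$ and $n\ge 1$, let $I$ be the extension to $R=K[x_1,\dots,x_n]$ of the ideal $\mathcal W_{m-1}(\Delta h)$, constructed in $K[x_1,\dots,x_{n-1}]$; for $d=0,1,2,\dots$ in turn, enlarge the current ideal $I$ by the largest $\dim_K(R/I)_d-h_d$ monomials in the rev-lex order among the monomials of degree $d$ not in $I$. Then $\mathcal W_m(h)$ is the union of these ideals. If $m\ge 1$ and $n=0$ (so $h=(1,0,0,\dots)$ and $R=K$), $\mathcal W_m(h)=0$. **Proposition 3.2.** 1. Let $h$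 be an $m$-times weak Lefschetz O-sequence and $R=K[x_1,\dots,x_{h_1}]$. Then $\mathcal W_m(h)$ is a strongly stable monomial ideal (that is, if $M\in\mathcal W_m(h)$ is a monomial, $x_k\mid M$ and $i<k$, then $(x_i/x_k)M\in\mathcal W_m(h)$), $R/\mathcal W_m(h)$ has Hilbert function $h$, and $R/\mathcal W_m(h)$ is Artinian and has the WLP $m$ times. 2. A sequence $h$ of natural numbers is an $m$-times weak Lefschetz O-sequence if and only if it is the Hilbert function of an Artinian algebra $K[x_1,\dots,x_n]/I$, for some $n\ge 0$ and some homogeneous ideal $I\ne(1)$, that has the WLP $m$ times. -/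

import Mathlib

open MvPolynomial

/-! ## Graded quotients of polynomial rings and their Hilbert functions -/

attribute [local instance] MvPolynomial.gradedAlgebra

/-- `I` is a homogeneous ideal of `R = K[x_1, …, x_n]` (standard grading). -/
def IsHomogIdeal {K : Type*} [Field K] {n : ℕ} (I : Ideal (MvPolynomial (Fin n) K)) : Prop :=
  I.IsHomogeneous (homogeneousSubmodule (Fin n) K)

/-- The component `A_d` of degree `d` of `A = R / I`: the residue classes of the forms of
degree `d`. -/
noncomputable def gradedPiece {K : Type*} [Field K] {n : ℕ} (I : Ideal (MvPolynomial (Fin n) K)) (d : ℕ) :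
    Submodule K (MvPolynomial (Fin n) K ⧸ I) :=
  (homogeneousSubmodule (Fin n) K d).map (Ideal.Quotient.mkₐ K I).toLinearMap

/-- The Hilbert function `d ↦ dim_K A_d` of `A = R / I`. -/
noncomputable def hilbertFunction {K : Type*} [Field K] {n : ℕ}
    (I : Ideal (MvPolynomial (Fin n) K)) (d : ℕ) : ℕ :=
  Module.finrank K (gradedPiece I d)

/-! ## The weak Lefschetz property -/

/-- The linear form `l` is (a representative of) a weak Lefschetz element of `A = R / I`:
multiplication by `l` from `A_d` to `A_{d+1}` has maximal rank, that is, it is injective or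
surjective, for every `d ≥ 1`. -/
def IsWeakLefschetzElement {K : Type*} [Field K] {n : ℕ} (I : Ideal (MvPolynomial (Fin n) K))
    (l : MvPolynomial (Fin n) K) : Prop :=
  l.IsHomogeneous 1 ∧ ∀ d : ℕ, 1 ≤ d →
    (∀ a ∈ gradedPiece I d, Ideal.Quotient.mk I l * a = 0 → a = 0) ∨
    (∀ b ∈ gradedPiece I (d + 1), ∃ a ∈ gradedPiece I d, Ideal.Quotient.mk I l * a = b)

/-- `A = R / I` has `m` times the weak Lefschetz property: there are linear forms
`l_1, …, l_m` such that `l_i` is a weak Lefschetz element of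
`A / (l_1, …, l_{i-1}) = R / (I + (l_1, …, l_{i-1}))` for every `i`. -/
def HasWLPTimes {K : Type*} [Field K] {n : ℕ} (m : ℕ) (I : Ideal (MvPolynomial (Fin n) K)) :
    Prop :=
  ∃ l : Fin m → MvPolynomial (Fin n) K,
    ∀ i : Fin m, IsWeakLefschetzElement (I ⊔ Ideal.span {f | ∃ j < i, f = l j}) (l i)

/-! ## O-sequences

A finite sequence `h_0, …, h_s` is identified with its extension by zeros `ℕ → ℕ`. -/

/-- `h` is an O-sequence starting with `1`: the Hilbert function of a nonzero standard graded
`K`-algebra. -/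
def IsOSequence (K : Type*) [Field K] (h : ℕ → ℕ) : Prop :=
  ∃ (n : ℕ) (I : Ideal (MvPolynomial (Fin n) K)),
    IsHomogIdeal I ∧ I ≠ ⊤ ∧ ∀ d, hilbertFunction I d = h d

/-- `h` is a finite O-sequence. -/
def IsFiniteOSequence (K : Type*) [Field K] (h : ℕ → ℕ) : Prop :=
  IsOSequence K h ∧ ∃ s, ∀ d, s < d → h d = 0

/-- `h_0 < h_1 < ⋯ < h_k ≥ h_{k+1} ≥ ⋯` for some `k`. -/
def IsUnimodalSeq (h : ℕ → ℕ) : Prop :=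
  ∃ k, (∀ i, i < k → h i < h (i + 1)) ∧ (∀ i, k ≤ i → h (i + 1) ≤ h i)

/-- The sequence `Δh`. The subtraction is that of natural numbers, so if
`h_0 < ⋯ < h_k ≥ h_{k+1} ≥ ⋯` then `Δh` is `h_0, h_1 - h_0, …, h_k - h_{k-1}, 0, 0, …`. -/
def deltaSeq (h : ℕ → ℕ) : ℕ → ℕ
  | 0 => h 0
  | d + 1 => h (d + 1) - h d

/-- `h` is an `m`-times weak Lefschetz O-sequence; `0`-times just means a finite O-sequence. -/
def IsWeakLefschetzOSequence (K : Type*) [Field K] : ℕ → (ℕ → ℕ) → Prop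
  | 0, h => IsFiniteOSequence K h
  | m + 1, h => IsFiniteOSequence K h ∧ IsUnimodalSeq h ∧
      IsWeakLefschetzOSequence K m (deltaSeq h)

/-! ## Monomials, monomial orders, strongly stable ideals

A monomial of `R` is given by its vector of exponents `u : Fin n →₀ ℕ`; the variables are
`x_1 = X 0, …, x_n = X (n - 1)`, and `x_1 > x_2 > ⋯ > x_n` in both orders. -/

/-- `u > v` in the lexicographic order. -/
def LexGT {n : ℕ} (u v : Fin n →₀ ℕ) : Prop := toLex v < toLex u

/-- `u > v` in the reverse lexicographic order, for monomials `u`, `v` of the same degree: the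
last variable in which `u` and `v` differ has the smaller exponent in `u`. -/
def RevLexGT {n : ℕ} (u v : Fin n →₀ ℕ) : Prop :=
  ∃ i, u i < v i ∧ ∀ j, i < j → u j = v j

/-- The `r` largest elements of the finite set `S` with respect to a strict total order
`gt` (all of `S`, if `S` has at most `r` elements). -/
noncomputable def largest {α : Type*} (gt : α → α → Prop) (r : ℕ) (S : Finset α) : Finset α :=
  open Classical in S.filter fun u => (S.filter fun v => gt v u).card < r

/-- The monomials of degree `d`. -/
noncomputable def monomialsOfDegree (n d : ℕ) : Finset (Fin n →₀ ℕ) :=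
  Finset.finsuppAntidiag Finset.univ d

/-- The monomials of degree `d` that do not belong to `I`. -/
noncomputable def missingMonomials {K : Type*} [Field K] {n : ℕ}
    (I : Ideal (MvPolynomial (Fin n) K)) (d : ℕ) : Finset (Fin n →₀ ℕ) :=
  open Classical in (monomialsOfDegree n d).filter fun u => monomial u (1 : K) ∉ I

/-- The ideal generated by a set of monomials. -/
noncomputable def monomialIdeal (K : Type*) [Field K] {n : ℕ} (S : Set (Fin n →₀ ℕ)) :
    Ideal (MvPolynomial (Fin n) K) :=
  Ideal.span ((fun u => monomial u (1 : K)) '' S)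

/-- `I` is a strongly stable monomial ideal: if `M` is a monomial in `I`, `x_k` divides `M` and
`i < k`, then `(x_i / x_k) M` is in `I`. -/
def IsStronglyStable {K : Type*} [Field K] {n : ℕ} (I : Ideal (MvPolynomial (Fin n) K)) : Prop :=
  (∃ S : Set (Fin n →₀ ℕ), I = monomialIdeal K S) ∧
  ∀ u : Fin n →₀ ℕ, monomial u (1 : K) ∈ I → ∀ i k : Fin n, i < k → 0 < u k →
    monomial (u - Finsupp.single k 1 + Finsupp.single i 1) (1 : K) ∈ I

/-! ## The ideal `W_m(h)` -/

/-- The lex-segment ideal `Lex(h)` in `n` variables: in each degree `d` one takes the largest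
`dim R_d - h_d` monomials in the lexicographic order. -/
noncomputable def lexIdeal (K : Type*) [Field K] (n : ℕ) (h : ℕ → ℕ) :
    Ideal (MvPolynomial (Fin n) K) :=
  monomialIdeal K
    (⋃ d, ↑(largest LexGT ((monomialsOfDegree n d).card - h d) (monomialsOfDegree n d)))

/-- The extension `J R` of an ideal `J` of `K[x_1, …, x_n]` to `R = K[x_1, …, x_{n+1}]`. -/
noncomputable def extendIdeal {K : Type*} [Field K] {n : ℕ}
    (J : Ideal (MvPolynomial (Fin n) K)) : Ideal (MvPolynomial (Fin (n + 1)) K) :=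
  J.map (rename Fin.castSucc : MvPolynomial (Fin n) K →ₐ[K] MvPolynomial (Fin (n + 1)) K)

/-- One step of the construction, in degree `d`: with `r = dim (R / I)_d - h_d`, add to `I` the
`r` largest monomials in the reverse lexicographic order among the monomials of degree `d`
that are not in `I`. -/
noncomputable def addLargest {K : Type*} [Field K] {n : ℕ} (h : ℕ → ℕ)
    (I : Ideal (MvPolynomial (Fin n) K)) (d : ℕ) : Ideal (MvPolynomial (Fin n) K) :=
  I ⊔ monomialIdeal K ↑(largest RevLexGT (hilbertFunction I d - h d) (missingMonomials I d))

/-- Starting from `I`, perform the steps in the degrees `0, 1, …, d - 1`, in this order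
(a step in a degree in which the Hilbert function is already the right one changes nothing). -/
noncomputable def fillBelow {K : Type*} [Field K] {n : ℕ} (h : ℕ → ℕ)
    (I : Ideal (MvPolynomial (Fin n) K)) : ℕ → Ideal (MvPolynomial (Fin n) K)
  | 0 => I
  | d + 1 => addLargest h (fillBelow h I d) d

/-- The ideal obtained from `I` by performing the steps in all degrees. -/
noncomputable def fillIdeal {K : Type*} [Field K] {n : ℕ} (h : ℕ → ℕ)
    (I : Ideal (MvPolynomial (Fin n) K)) : Ideal (MvPolynomial (Fin n) K) :=
  ⨆ d, fillBelow h I d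

/-- The inductive construction of `W_m(h)` in `n` variables: `W_0(h) = Lex(h)`, and
`W_{m+1}(h)` is obtained from the extension of `W_m(Δh)`, which lives in one variable less, by
adding the largest missing monomials in each degree. If no variable is left (this occurs only
for the sequence `1, 0, 0, …`, with `R = K`), the ideal is zero. -/
noncomputable def lefschetzIdealAux (K : Type*) [Field K] :
    ℕ → (n : ℕ) → (ℕ → ℕ) → Ideal (MvPolynomial (Fin n) K)
  | 0, n, h => lexIdeal K n h
  | _ + 1, 0, _ => ⊥
  | m + 1, n + 1, h => fillIdeal h (extendIdeal (lefschetzIdealAux K m n (deltaSeq h)))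

/-- The ideal `W_m(h)` of the polynomial ring in `h_1` variables. -/
noncomputable def lefschetzIdeal (K : Type*) [Field K] (m : ℕ) (h : ℕ → ℕ) :
    Ideal (MvPolynomial (Fin (h 1)) K) :=
  lefschetzIdealAux K m (h 1) h

/-!
Both parts rest on a description of Hilbert functions by monomials. For every ideal `I` the
monomials that are not congruent modulo `I` to combinations of smaller ones of the same degree
(`stdMonomials`) form an order ideal, and they are counted by the Hilbert function
(`hilbertFunction_eq_card`); for a monomial ideal they are the monomials outside of it.

*The lex ideals (`m = 0`).* By the above, an O-sequence counts an order ideal of monomials, so one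
needs Macaulay's theorem that among the sets of `r` monomials of degree `d` the lex segment has the
smallest upper shadow (`lexShadowMinimal`). This is proved by induction on the number of variables.
Compressing a set of monomials with respect to pairs of variables does not enlarge its shadow
(`upShadow_compress_subset`), and makes it stable with respect to the last variable. The shadow of
a stable set has as many elements as the set and the shadow of its part free of the last variable
together, and among stable sets the lex segment has the smallest such part (`card_slice_zero_le`,
a combinatorial form of the hyperplane restriction theorem).

*The step from `m` to `m + 1`.* Let `N` be the finite set of monomials outside `J = W_m(Δh)`. The
monomials of degree `d` outside the extension of `J` are the `u x_{n+1}^{d - |u|}` with `u` in `N`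
and `|u| ≤ d`, and the reverse lexicographic order on them is the degree reverse lexicographic
order on the `u`, whatever `d` is. As `h` decreases from the place `k` after which `Δh` vanishes,
filling up just keeps the `h_d` smallest elements of `N` in degree `d`
(`IsFillData.monomial_notMem_fillIdeal_iff`). From this one reads off the Hilbert function, strong
stability, the weak Lefschetz property of `x_{n+1}`, and that setting `x_{n+1} = 0` leads back to
`J`, so that the Lefschetz elements of `J` prolong the sequence (`hasWLPTimes_succ`).

*Necessity.* If the multiplications by `l` have maximal rank, then the Hilbert function of `A` is
unimodal, and that of `A / l` is its `Δ`; induct on `m`. The definition of weak Lefschetz elements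
ignores degree zero, so `l` may be zero in `A`; but then `A` vanishes in degree two, and a nonzero
linear form can be used instead.
-/

/-! ### Monomials and their last variable -/

theorem mem_monomialsOfDegree {n d : ℕ} {u : Fin n →₀ ℕ} :
    u ∈ monomialsOfDegree n d ↔ u.degree = d := by
  simp [monomialsOfDegree, Finset.mem_finsuppAntidiag, Finsupp.degree_eq_sum]

/-- The monomial `u * x_{n+1}^a` in `n + 1` variables. -/
noncomputable def snocMon {n : ℕ} (u : Fin n →₀ ℕ) (a : ℕ) : Fin (n + 1) →₀ ℕ :=
  Finsupp.equivFunOnFinite.symm (Fin.snoc (α := fun _ => ℕ) u a)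

/-- The monomial in `n` variables obtained by setting the last variable equal to `1`. -/
noncomputable def initMon {n : ℕ} (w : Fin (n + 1) →₀ ℕ) : Fin n →₀ ℕ :=
  Finsupp.equivFunOnFinite.symm fun i => w i.castSucc

@[simp] theorem snocMon_castSucc {n : ℕ} (u : Fin n →₀ ℕ) (a : ℕ) (i : Fin n) :
    snocMon u a i.castSucc = u i := by
  simp [snocMon]

@[simp] theorem snocMon_last {n : ℕ} (u : Fin n →₀ ℕ) (a : ℕ) :
    snocMon u a (Fin.last n) = a := by
  simp [snocMon]

@[simp] theorem initMon_apply {n : ℕ} (w : Fin (n + 1) →₀ ℕ) (i : Fin n) :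
    initMon w i = w i.castSucc := by
  simp [initMon]

@[simp] theorem initMon_snocMon {n : ℕ} (u : Fin n →₀ ℕ) (a : ℕ) : initMon (snocMon u a) = u := by
  ext i; simp

@[simp] theorem snocMon_initMon {n : ℕ} (w : Fin (n + 1) →₀ ℕ) :
    snocMon (initMon w) (w (Fin.last n)) = w := by
  ext i; refine Fin.lastCases ?_ (fun i => ?_) i <;> simp

@[simp] theorem degree_snocMon {n : ℕ} (u : Fin n →₀ ℕ) (a : ℕ) :
    (snocMon u a).degree = u.degree + a := by
  simp [Finsupp.degree_eq_sum, Fin.sum_univ_castSucc]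

theorem degree_eq_degree_initMon_add {n : ℕ} (w : Fin (n + 1) →₀ ℕ) :
    w.degree = (initMon w).degree + w (Fin.last n) := by
  simp [Finsupp.degree_eq_sum, Fin.sum_univ_castSucc]

theorem eq_of_initMon_eq {n : ℕ} {v w : Fin (n + 1) →₀ ℕ} (h : initMon v = initMon w)
    (hd : v.degree = w.degree) : v = w := by
  rw [degree_eq_degree_initMon_add v, degree_eq_degree_initMon_add w, h] at hd
  rw [← snocMon_initMon v, ← snocMon_initMon w, h, Nat.add_left_cancel hd]

theorem initMon_add_single_last {n : ℕ} (w : Fin (n + 1) →₀ ℕ) (a : ℕ) :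
    initMon (w + Finsupp.single (Fin.last n) a) = initMon w := by
  ext i; simp

theorem snocMon_add_single_castSucc {n : ℕ} (u : Fin n →₀ ℕ) (a : ℕ) (i : Fin n) (b : ℕ) :
    snocMon u a + Finsupp.single i.castSucc b = snocMon (u + Finsupp.single i b) a := by
  ext j; refine Fin.lastCases ?_ (fun j => ?_) j <;>
    simp [Finsupp.single_apply, Fin.castSucc_ne_last]

theorem snocMon_add_single_last {n : ℕ} (u : Fin n →₀ ℕ) (a b : ℕ) :
    snocMon u a + Finsupp.single (Fin.last n) b = snocMon u (a + b) := by
  ext j; refine Fin.lastCases ?_ (fun j => ?_) j <;>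
    simp

/-! ### The lexicographic order and lex segments -/

theorem lexGT_iff {n : ℕ} {u v : Fin n →₀ ℕ} :
    LexGT u v ↔ ∃ i, (∀ j, j < i → v j = u j) ∧ v i < u i :=
  Iff.rfl

theorem LexGT.trans {n : ℕ} {u v w : Fin n →₀ ℕ} (h : LexGT u v) (h' : LexGT v w) : LexGT u w :=
  lt_trans (α := Lex (Fin n →₀ ℕ)) h' h

theorem LexGT.irrefl {n : ℕ} (u : Fin n →₀ ℕ) : ¬ LexGT u u :=
  lt_irrefl (α := Lex (Fin n →₀ ℕ)) _

theorem lexGT_trichotomy {n : ℕ} (u v : Fin n →₀ ℕ) : LexGT u v ∨ u = v ∨ LexGT v u := by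
  rcases lt_trichotomy (toLex u) (toLex v) with h | h | h
  · exact Or.inr (Or.inr h)
  · exact Or.inr (Or.inl (toLex.injective h))
  · exact Or.inl h

theorem LexGT.add_right {n : ℕ} {u v : Fin n →₀ ℕ} (h : LexGT u v) (c : Fin n →₀ ℕ) :
    LexGT (u + c) (v + c) := by
  obtain ⟨i, hi, hlt⟩ := lexGT_iff.1 h
  exact lexGT_iff.2 ⟨i, fun j hj => by simp [hi j hj], by simpa using hlt⟩

/-- A lex segment in degree `d`: a set of monomials of degree `d` that contains, with each
monomial, all the larger ones of degree `d`. -/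
structure IsLexSeg {n : ℕ} (d : ℕ) (L : Finset (Fin n →₀ ℕ)) : Prop where
  subset : L ⊆ monomialsOfDegree n d
  upward : ∀ u ∈ L, ∀ v ∈ monomialsOfDegree n d, LexGT v u → v ∈ L

theorem IsLexSeg.subset_of_mem_of_notMem {n d : ℕ} {L L' : Finset (Fin n →₀ ℕ)}
    (hL : IsLexSeg d L) (hL' : IsLexSeg d L') {u : Fin n →₀ ℕ} (hu : u ∈ L) (hu' : u ∉ L') :
    L' ⊆ L := by
  intro v hv
  rcases lexGT_trichotomy u v with h | h | h
  · exact absurd (hL'.upward v hv u (hL.subset hu) h) hu'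
  · exact h ▸ hu
  · exact hL.upward u hu v (hL'.subset hv) h

theorem IsLexSeg.subset_of_card_le {n d : ℕ} {L L' : Finset (Fin n →₀ ℕ)}
    (hL : IsLexSeg d L) (hL' : IsLexSeg d L') (h : L.card ≤ L'.card) : L ⊆ L' := by
  by_contra hn
  obtain ⟨u, hu, hu'⟩ := Finset.not_subset.1 hn
  have := hL.subset_of_mem_of_notMem hL' hu hu'
  exact hu' (Finset.eq_of_subset_of_card_le this h ▸ hu)

/-- The upper shadow of a set of monomials: all products with a variable. -/
noncomputable def upShadow {n : ℕ} (A : Finset (Fin n →₀ ℕ)) : Finset (Fin n →₀ ℕ) :=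
  open Classical in A.biUnion fun u => Finset.univ.image fun i => u + Finsupp.single i 1

theorem mem_upShadow {n : ℕ} {A : Finset (Fin n →₀ ℕ)} {w : Fin n →₀ ℕ} :
    w ∈ upShadow A ↔ ∃ u ∈ A, ∃ i, u + Finsupp.single i 1 = w := by
  simp [upShadow]

theorem add_single_mem_upShadow {n : ℕ} {A : Finset (Fin n →₀ ℕ)} {u : Fin n →₀ ℕ} (hu : u ∈ A)
    (i : Fin n) : u + Finsupp.single i 1 ∈ upShadow A :=
  mem_upShadow.2 ⟨u, hu, i, rfl⟩

theorem upShadow_subset {n d : ℕ} {A : Finset (Fin n →₀ ℕ)} (h : A ⊆ monomialsOfDegree n d) :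
    upShadow A ⊆ monomialsOfDegree n (d + 1) := by
  intro w hw
  obtain ⟨u, hu, i, rfl⟩ := mem_upShadow.1 hw
  have := mem_monomialsOfDegree.1 (h hu)
  simp [mem_monomialsOfDegree, this]

/-- Let `v > u x_i` have degree `d + 1`. If `x_k` is the last variable dividing `v`, then
`v / x_k ≥ u`. -/
theorem IsLexSeg.upShadow {n d : ℕ} {L : Finset (Fin n →₀ ℕ)} (hL : IsLexSeg d L) :
    IsLexSeg (d + 1) (upShadow L) := by
  refine ⟨upShadow_subset hL.subset, fun w hw v hv hvw => ?_⟩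
  obtain ⟨u, hu, i, rfl⟩ := mem_upShadow.1 hw
  obtain ⟨p, hp, hlt⟩ := lexGT_iff.1 hvw
  have hud := mem_monomialsOfDegree.1 (hL.subset hu)
  have hvd := mem_monomialsOfDegree.1 hv
  have hvp : v p ≠ 0 := by omega
  have hne : v.support.Nonempty := ⟨p, by simpa using hvp⟩
  set k := v.support.max' hne with hk
  have hvk : v k ≠ 0 := by simpa using v.support.max'_mem hne
  have hpk : p ≤ k := v.support.le_max' p (by simpa using hvp)
  have hle : Finsupp.single k 1 ≤ v := by simpa using Nat.one_le_iff_ne_zero.2 hvk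
  obtain ⟨v', hv'⟩ : ∃ v', v = v' + Finsupp.single k 1 := ⟨_, (tsub_add_cancel_of_le hle).symm⟩
  have hvd' : v'.degree = d := by
    have h1 := congrArg Finsupp.degree hv'
    simp only [map_add, Finsupp.degree_single] at h1
    omega
  have hva : ∀ j, v j = v' j + if k = j then 1 else 0 := fun j => by
    simp [hv', Finsupp.single_apply]
  have hua : ∀ j, u j ≤ (u + Finsupp.single i 1 : Fin n →₀ ℕ) j := by simp
  have hmem : v' ∈ L := by
    rcases lexGT_trichotomy v' u with h | h | h
    · exact hL.upward u hu _ (mem_monomialsOfDegree.2 hvd') h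
    · exact h ▸ hu
    · exfalso
      obtain ⟨q, hq, hlt'⟩ := lexGT_iff.1 h
      have hle' : ∀ j ≤ p, u j ≤ v' j := by
        intro j hj
        have h1 := hva j
        have h2 := hua j
        rcases hj.lt_or_eq with hj | rfl
        · rw [if_neg (by rintro rfl; omega)] at h1
          have := hp j hj
          omega
        · split_ifs at h1 <;> omega
      have hpq : p < q := by
        by_contra hc
        have := hle' q (not_lt.1 hc)
        omega
      -- `v'` and `u` agree up to `x_p`; so `k = p`, and `u` is a proper multiple of `v'`
      have h1 : v' p = u p := hq p hpq
      have hkp : k = p := by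
        by_contra hc
        have h2 := hva p
        have := hua p
        rw [if_neg hc] at h2
        omega
      have hlt2 : v' < u := by
        refine lt_of_le_of_ne (fun j => ?_) (fun he => by rw [he] at hlt'; omega)
        rcases lt_or_ge j q with hj | hj
        · exact (hq j hj).le
        · have : v j = 0 := by
            by_contra hc
            have := v.support.le_max' j (by simpa using hc)
            omega
          have h2 := hva j
          omega
      obtain ⟨c, hc⟩ := exists_add_of_le hlt2.le
      have h3 := congrArg Finsupp.degree hc
      rw [map_add, hud, hvd'] at h3
      have : c = 0 := by rw [← Finsupp.degree_eq_zero_iff]; omega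
      rw [this, add_zero] at hc
      exact hlt2.ne hc.symm
  exact hv' ▸ add_single_mem_upShadow hmem k

/-! ### Ranks in finite linear orders -/

section Rank

variable {α : Type*} {S : Finset α} {lt : α → α → Prop}

theorem card_filter_lt_card_filter [DecidableRel lt] (htrans : ∀ a b c, lt a b → lt b c → lt a c)
    (hirr : ∀ a, ¬ lt a a) {a b : α} (ha : a ∈ S) (hab : lt a b) :
    (S.filter fun v => lt v a).card < (S.filter fun v => lt v b).card := by
  refine Finset.card_lt_card (Finset.ssubset_iff_subset_ne.2 ⟨fun v hv => ?_, fun he => ?_⟩)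
  · rw [Finset.mem_filter] at hv ⊢
    exact ⟨hv.1, htrans _ _ _ hv.2 hab⟩
  · have : a ∈ S.filter fun v => lt v a := he ▸ Finset.mem_filter.2 ⟨ha, hab⟩
    exact hirr a (Finset.mem_filter.1 this).2

theorem injOn_rank [DecidableRel lt] (htrans : ∀ a b c, lt a b → lt b c → lt a c) (hirr : ∀ a, ¬ lt a a)
    (htot : ∀ a ∈ S, ∀ b ∈ S, a ≠ b → lt a b ∨ lt b a) :
    Set.InjOn (fun u => (S.filter fun v => lt v u).card) S := by
  intro a ha b hb hab
  by_contra hne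
  rcases htot a ha b hb hne with h | h
  · exact (card_filter_lt_card_filter htrans hirr ha h).ne hab
  · exact (card_filter_lt_card_filter htrans hirr hb h).ne' hab

theorem image_rank [DecidableRel lt] (htrans : ∀ a b c, lt a b → lt b c → lt a c) (hirr : ∀ a, ¬ lt a a)
    (htot : ∀ a ∈ S, ∀ b ∈ S, a ≠ b → lt a b ∨ lt b a) :
    S.image (fun u => (S.filter fun v => lt v u).card) = Finset.range S.card := by
  refine Finset.eq_of_subset_of_card_le (fun r hr => ?_) ?_
  · obtain ⟨u, hu, rfl⟩ := Finset.mem_image.1 hr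
    refine Finset.mem_range.2 (Finset.card_lt_card (Finset.filter_ssubset.2 ⟨u, hu, hirr u⟩))
  · rw [Finset.card_image_of_injOn (injOn_rank htrans hirr htot), Finset.card_range]

theorem card_filter_rank_lt [DecidableRel lt] (htrans : ∀ a b c, lt a b → lt b c → lt a c) (hirr : ∀ a, ¬ lt a a)
    (htot : ∀ a ∈ S, ∀ b ∈ S, a ≠ b → lt a b ∨ lt b a) {r : ℕ} (hr : r ≤ S.card) :
    (S.filter fun u => (S.filter fun v => lt v u).card < r).card = r := by
  have h1 := image_rank htrans hirr htot
  rw [← Finset.card_image_of_injOn ((injOn_rank htrans hirr htot).mono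
      (Finset.coe_subset.2 (Finset.filter_subset _ _))),
    ← Finset.filter_image (p := fun x => x < r), h1]
  have : (Finset.range S.card).filter (fun x => x < r) = Finset.range r := by
    ext x; simp; omega
  rw [this, Finset.card_range]

open Classical in
/-- In a set of `r + s` elements, the `r` largest ones are those above at least `s` others. -/
theorem mem_largest_sub (htrans : ∀ a b c, lt a b → lt b c → lt a c) (hirr : ∀ a, ¬ lt a a)
    (htot : ∀ a ∈ S, ∀ b ∈ S, a ≠ b → lt a b ∨ lt b a) {s : ℕ} {u : α} :
    u ∈ largest lt (S.card - s) S ↔ u ∈ S ∧ s ≤ (S.filter fun v => lt u v).card := by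
  simp only [largest, Finset.mem_filter]
  refine and_congr_right fun hu => ?_
  have h1 : S = insert u ((S.filter fun v => lt v u) ∪ (S.filter fun v => lt u v)) := by
    ext v
    simp only [Finset.mem_insert, Finset.mem_union, Finset.mem_filter]
    constructor
    · intro hv
      by_cases h : v = u
      · exact Or.inl h
      · rcases htot v hv u hu h with h | h
        · exact Or.inr (Or.inl ⟨hv, h⟩)
        · exact Or.inr (Or.inr ⟨hv, h⟩)
    · rintro (rfl | h | h)
      exacts [hu, h.1, h.1]
  have h2 := congrArg Finset.card h1
  rw [Finset.card_insert_of_notMem (by simp [hirr]), Finset.card_union_of_disjoint] at h2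
  · omega
  · rw [Finset.disjoint_filter]
    exact fun v _ h h' => hirr v (htrans _ _ _ h h')

end Rank

theorem isLexSeg_largest (n d r : ℕ) :
    IsLexSeg d (largest LexGT r (monomialsOfDegree n d)) := by
  classical
  refine ⟨Finset.filter_subset _ _, fun u hu v hv hvu => ?_⟩
  rw [largest, Finset.mem_filter] at hu ⊢
  refine ⟨hv, lt_of_le_of_lt (Finset.card_le_card fun w hw => ?_) hu.2⟩
  rw [Finset.mem_filter] at hw ⊢
  exact ⟨hw.1, hw.2.trans hvu⟩

theorem card_largest_lexGT {n d r : ℕ} (hr : r ≤ (monomialsOfDegree n d).card) :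
    (largest LexGT r (monomialsOfDegree n d)).card = r := by
  classical
  refine Eq.trans ?_ (card_filter_rank_lt (S := monomialsOfDegree n d) (lt := LexGT)
    (fun _ _ _ h h' => h.trans h') LexGT.irrefl (fun a _ b _ hab => ?_) hr)
  · rw [largest]
  · rcases lexGT_trichotomy a b with h | h | h
    exacts [Or.inl h, absurd h hab, Or.inr h]

/-! ### Slices with respect to the last variable -/

/-- The monomials `w` in the first `n` variables such that `w * x_{n+1}^j` belongs to `A`. -/
noncomputable def slice {n : ℕ} (A : Finset (Fin (n + 1) →₀ ℕ)) (j : ℕ) : Finset (Fin n →₀ ℕ) :=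
  open Classical in (A.filter fun u => u (Fin.last n) = j).image initMon

theorem mem_slice {n : ℕ} {A : Finset (Fin (n + 1) →₀ ℕ)} {j : ℕ} {w : Fin n →₀ ℕ} :
    w ∈ slice A j ↔ snocMon w j ∈ A := by
  simp only [slice, Finset.mem_image, Finset.mem_filter]
  constructor
  · rintro ⟨u, ⟨hu, rfl⟩, rfl⟩
    simpa using hu
  · exact fun h => ⟨_, ⟨h, by simp⟩, by simp⟩

theorem slice_subset {n d j : ℕ} {A : Finset (Fin (n + 1) →₀ ℕ)}
    (hA : A ⊆ monomialsOfDegree (n + 1) d) : slice A j ⊆ monomialsOfDegree n (d - j) := by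
  intro w hw
  have := mem_monomialsOfDegree.1 (hA (mem_slice.1 hw))
  rw [degree_snocMon] at this
  exact mem_monomialsOfDegree.2 (by omega)

theorem card_eq_sum_card_slice {n d : ℕ} {A : Finset (Fin (n + 1) →₀ ℕ)}
    (hA : A ⊆ monomialsOfDegree (n + 1) d) :
    A.card = ∑ j ∈ Finset.range (d + 1), (slice A j).card := by
  classical
  rw [Finset.card_eq_sum_card_fiberwise (f := fun u => u (Fin.last n)) (t := Finset.range (d + 1))]
  · refine Finset.sum_congr rfl fun j _ => ?_
    rw [slice, Finset.card_image_of_injOn]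
    · intro u hu v hv huv
      simp only [Finset.coe_filter, Set.mem_ofPred_eq] at hu hv
      rw [← snocMon_initMon u, ← snocMon_initMon v, huv, hu.2, hv.2]
  · intro u hu
    have := mem_monomialsOfDegree.1 (hA hu)
    rw [degree_eq_degree_initMon_add] at this
    simp only [Finset.coe_range, Set.mem_Iio]
    omega

theorem lexGT_snocMon_of_lexGT {n : ℕ} {u v : Fin n →₀ ℕ} (h : LexGT u v) (a b : ℕ) :
    LexGT (snocMon u a) (snocMon v b) := by
  obtain ⟨i, hi, hlt⟩ := lexGT_iff.1 h
  refine lexGT_iff.2 ⟨i.castSucc, fun j hj => ?_, by simpa using hlt⟩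
  have hjn : j ≠ Fin.last n := (hj.trans (Fin.castSucc_lt_last i)).ne
  obtain ⟨j, rfl⟩ := Fin.exists_castSucc_eq.2 hjn
  simpa using hi j (by simpa using hj)

theorem IsLexSeg.slice {n d : ℕ} {L : Finset (Fin (n + 1) →₀ ℕ)} (hL : IsLexSeg d L) {j : ℕ}
    (hj : j ≤ d) : IsLexSeg (d - j) (slice L j) := by
  refine ⟨slice_subset hL.subset, fun u hu v hv hvu => ?_⟩
  rw [mem_slice] at hu ⊢
  refine hL.upward _ hu _ (mem_monomialsOfDegree.2 ?_) (lexGT_snocMon_of_lexGT hvu j j)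
  rw [degree_snocMon, mem_monomialsOfDegree.1 hv]
  omega

/-- `x_{n+1} A` and the products of the slice without `x_{n+1}` with the other variables are
disjoint parts of the shadow. -/
theorem card_add_card_upShadow_slice_le {n : ℕ} (A : Finset (Fin (n + 1) →₀ ℕ)) :
    A.card + (upShadow (slice A 0)).card ≤ (upShadow A).card := by
  classical
  have h1 : (A.image fun u => u + Finsupp.single (Fin.last n) 1).card = A.card :=
    Finset.card_image_of_injective _ (add_left_injective _)
  have h2 : ((upShadow (slice A 0)).image fun u => snocMon u 0).card =
      (upShadow (slice A 0)).card :=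
    Finset.card_image_of_injective _ fun u v h => by simpa using congrArg initMon h
  rw [← h1, ← h2, ← Finset.card_union_of_disjoint]
  · refine Finset.card_le_card (Finset.union_subset (fun w hw => ?_) fun w hw => ?_)
    · obtain ⟨u, hu, rfl⟩ := Finset.mem_image.1 hw
      exact add_single_mem_upShadow hu _
    · obtain ⟨u, hu, rfl⟩ := Finset.mem_image.1 hw
      obtain ⟨v, hv, i, rfl⟩ := mem_upShadow.1 hu
      rw [← snocMon_add_single_castSucc]
      exact add_single_mem_upShadow (mem_slice.1 hv) _
  · rw [Finset.disjoint_left]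
    intro w hw hw'
    obtain ⟨u, hu, rfl⟩ := Finset.mem_image.1 hw
    obtain ⟨v, hv, h⟩ := Finset.mem_image.1 hw'
    simpa using DFunLike.congr_fun h (Fin.last n)

/-- A set of monomials is stable with respect to the last variable if a factor `x_{n+1}` may
always be replaced by any other variable. -/
def IsLastStable {n : ℕ} (A : Finset (Fin (n + 1) →₀ ℕ)) : Prop :=
  ∀ (w : Fin n →₀ ℕ) (j : ℕ), snocMon w (j + 1) ∈ A → ∀ i, snocMon (w + Finsupp.single i 1) j ∈ A

theorem IsLexSeg.isLastStable {n d : ℕ} {L : Finset (Fin (n + 1) →₀ ℕ)} (hL : IsLexSeg d L) :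
    IsLastStable L := by
  intro w j hw i
  have := mem_monomialsOfDegree.1 (hL.subset hw)
  rw [degree_snocMon] at this
  refine hL.upward _ hw _ (mem_monomialsOfDegree.2 ?_) (lexGT_snocMon_of_lexGT ?_ _ _)
  · simp only [degree_snocMon, map_add, Finsupp.degree_single]
    omega
  · refine lexGT_iff.2 ⟨i, fun k hk => ?_, by simp⟩
    simp [hk.ne']

theorem IsLastStable.card_upShadow_le {n : ℕ} {A : Finset (Fin (n + 1) →₀ ℕ)}
    (hA : IsLastStable A) : (upShadow A).card ≤ A.card + (upShadow (slice A 0)).card := by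
  classical
  have : upShadow A ⊆ (A.image fun u => u + Finsupp.single (Fin.last n) 1) ∪
      ((upShadow (slice A 0)).image fun u => snocMon u 0) := by
    intro w hw
    obtain ⟨u, hu, i, rfl⟩ := mem_upShadow.1 hw
    rw [Finset.mem_union, Finset.mem_image, Finset.mem_image]
    induction i using Fin.lastCases with
    | last => exact Or.inl ⟨u, hu, rfl⟩
    | cast i =>
      obtain ⟨v, a, rfl⟩ : ∃ v a, u = snocMon v a := ⟨_, _, (snocMon_initMon u).symm⟩
      rw [snocMon_add_single_castSucc]
      cases a with
      | zero => exact Or.inr ⟨_, add_single_mem_upShadow (mem_slice.2 hu) i, rfl⟩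
      | succ a => exact Or.inl ⟨_, hA v a hu i, by rw [snocMon_add_single_last]⟩
  refine (Finset.card_le_card this).trans ((Finset.card_union_le _ _).trans ?_)
  exact Nat.add_le_add Finset.card_image_le Finset.card_image_le

/-! ### Compression with respect to two variables -/

section Compression

variable {n : ℕ} {p q : Fin n}

/-- `u` and `v` have the same exponents except perhaps in the variables `x_p` and `x_q`. -/
def SameOff (p q : Fin n) (u v : Fin n →₀ ℕ) : Prop := ∀ k, k ≠ p → k ≠ q → u k = v k

theorem SameOff.symm {u v : Fin n →₀ ℕ} (h : SameOff p q u v) : SameOff p q v u :=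
  fun k hp hq => (h k hp hq).symm

theorem SameOff.trans {u v w : Fin n →₀ ℕ} (h : SameOff p q u v) (h' : SameOff p q v w) :
    SameOff p q u w :=
  fun k hp hq => (h k hp hq).trans (h' k hp hq)

theorem SameOff.eq {u v : Fin n →₀ ℕ} (h : SameOff p q u v) (hd : u.degree = v.degree)
    (hq : u q = v q) : u = v := by
  have h1 : ∀ k, k ≠ p → u k = v k := fun k hk => by
    by_cases hkq : k = q
    · exact hkq ▸ hq
    · exact h k hk hkq
  ext k
  by_cases hk : k = p
  · subst hk
    rw [Finsupp.degree_eq_sum, Finsupp.degree_eq_sum, ← Finset.add_sum_erase _ _ (Finset.mem_univ k),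
      ← Finset.add_sum_erase _ _ (Finset.mem_univ k),
      Finset.sum_congr rfl fun j hj => h1 j (Finset.ne_of_mem_erase hj)] at hd
    exact Nat.add_right_cancel hd
  · exact h1 k hk

/-- The monomial obtained from `u` by lowering the exponent of `x_q` to `b` and raising that of
`x_p` by the same amount. -/
noncomputable def moveTo (p q : Fin n) (u : Fin n →₀ ℕ) (b : ℕ) : Fin n →₀ ℕ :=
  u - Finsupp.single q (u q - b) + Finsupp.single p (u q - b)

theorem sameOff_moveTo (u : Fin n →₀ ℕ) (b : ℕ) : SameOff p q u (moveTo p q u b) :=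
  fun k hp hq => by simp [moveTo, Ne.symm hp, Ne.symm hq]

theorem moveTo_apply (hpq : p ≠ q) {u : Fin n →₀ ℕ} {b : ℕ} (hb : b ≤ u q) :
    moveTo p q u b q = b := by
  simp only [moveTo, Finsupp.coe_add, Finsupp.coe_tsub, Pi.add_apply, Pi.sub_apply,
    Finsupp.single_apply, if_neg hpq, if_true]
  omega

theorem degree_moveTo (u : Fin n →₀ ℕ) (b : ℕ) : (moveTo p q u b).degree = u.degree := by
  have hle : Finsupp.single q (u q - b) ≤ u := by simp
  have h1 := congrArg Finsupp.degree (tsub_add_cancel_of_le hle)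
  simp only [map_add, Finsupp.degree_single, moveTo] at h1 ⊢
  exact h1

open Classical in
/-- The number of monomials of `A` that agree with `u` outside `x_p` and `x_q`, and have a smaller
exponent of `x_q`. -/
noncomputable def fibreRank (p q : Fin n) (A : Finset (Fin n →₀ ℕ)) (u : Fin n →₀ ℕ) : ℕ :=
  (A.filter fun v => SameOff p q u v ∧ v q < u q).card

open Classical in
/-- The compression of `A`: in each set of monomials agreeing outside `x_p` and `x_q`, the members
of `A` are replaced by equally many with the smallest possible exponents of `x_q`. -/
noncomputable def compress (p q : Fin n) (A : Finset (Fin n →₀ ℕ)) : Finset (Fin n →₀ ℕ) :=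
  A.image fun u => moveTo p q u (fibreRank p q A u)

variable {d : ℕ} {A : Finset (Fin n →₀ ℕ)}

open Classical in
theorem fibreRank_eq {u w : Fin n →₀ ℕ} (h : SameOff p q w u) :
    fibreRank p q A u = ((A.filter fun v => SameOff p q w v).filter fun v => v q < u q).card := by
  rw [fibreRank, Finset.filter_filter]
  congr 1
  ext v
  simp only [Finset.mem_filter, and_congr_right_iff, and_congr_left_iff]
  exact fun _ _ => ⟨fun h' => h.trans h', fun h' => h.symm.trans h'⟩

open Classical in
/-- Exponents of `x_q` distinguish the monomials of a fibre, so a fibre is linearly ordered. -/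
theorem fibre_total (hA : A ⊆ monomialsOfDegree n d) (w : Fin n →₀ ℕ) :
    ∀ a ∈ A.filter fun v => SameOff p q w v, ∀ b ∈ A.filter fun v => SameOff p q w v,
      a ≠ b → a q < b q ∨ b q < a q := by
  intro a ha b hb hab
  rw [Finset.mem_filter] at ha hb
  by_contra hc
  refine hab ((ha.2.symm.trans hb.2).eq ?_ (by omega))
  rw [mem_monomialsOfDegree.1 (hA ha.1), mem_monomialsOfDegree.1 (hA hb.1)]

theorem fibreRank_le (hA : A ⊆ monomialsOfDegree n d) (u : Fin n →₀ ℕ) :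
    fibreRank p q A u ≤ u q := by
  classical
  have h := Finset.card_le_card_of_injOn (s := A.filter fun v => SameOff p q u v ∧ v q < u q)
    (t := Finset.range (u q)) (fun v => v q)
    (fun v hv => by simpa using (Finset.mem_filter.1 hv).2.2) (fun v hv w hw hvw => ?_)
  · rw [Finset.card_range] at h
    exact h
  · rw [Finset.mem_coe, Finset.mem_filter] at hv hw
    refine (hv.2.1.symm.trans hw.2.1).eq ?_ hvw
    rw [mem_monomialsOfDegree.1 (hA hv.1), mem_monomialsOfDegree.1 (hA hw.1)]

open Classical in
theorem mem_compress (hpq : p ≠ q) (hA : A ⊆ monomialsOfDegree n d) {w : Fin n →₀ ℕ} :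
    w ∈ compress p q A ↔
      w ∈ monomialsOfDegree n d ∧ w q < (A.filter fun v => SameOff p q w v).card := by
  rw [compress, Finset.mem_image]
  constructor
  · rintro ⟨u, hu, rfl⟩
    refine ⟨?_, ?_⟩
    · rw [mem_monomialsOfDegree, degree_moveTo]
      exact mem_monomialsOfDegree.1 (hA hu)
    have hs : SameOff p q (moveTo p q u (fibreRank p q A u)) u := (sameOff_moveTo u _).symm
    rw [moveTo_apply hpq (fibreRank_le hA u)]
    refine lt_of_eq_of_lt (fibreRank_eq hs) ?_
    exact Finset.card_lt_card
      (Finset.filter_ssubset.2 ⟨u, Finset.mem_filter.2 ⟨hu, hs⟩, lt_irrefl _⟩)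
  · rintro ⟨hw, hlt⟩
    have h1 := image_rank (lt := fun a b : Fin n →₀ ℕ => a q < b q)
      (S := A.filter fun v => SameOff p q w v)
      (fun _ _ _ h h' => lt_trans h h') (fun _ => lt_irrefl _) (fibre_total hA w)
    obtain ⟨u, hu, hr⟩ := Finset.mem_image.1 (h1 ▸ Finset.mem_range.2 hlt)
    have hu := Finset.mem_filter.1 hu
    rw [← fibreRank_eq hu.2] at hr
    have hs : SameOff p q u (moveTo p q u (fibreRank p q A u)) := sameOff_moveTo u _
    refine ⟨u, hu.1, (hs.symm.trans hu.2.symm).eq ?_ ?_⟩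
    · rw [degree_moveTo, mem_monomialsOfDegree.1 hw, mem_monomialsOfDegree.1 (hA hu.1)]
    · rw [moveTo_apply hpq (fibreRank_le hA u), hr]

theorem injOn_moveTo_fibreRank (hpq : p ≠ q) (hA : A ⊆ monomialsOfDegree n d) :
    Set.InjOn (fun u => moveTo p q u (fibreRank p q A u)) A := by
  classical
  intro u hu v hv huv
  dsimp only at huv
  have hs : SameOff p q u v := by
    have h1 : SameOff p q u (moveTo p q u (fibreRank p q A u)) := sameOff_moveTo u _
    have h2 : SameOff p q v (moveTo p q v (fibreRank p q A v)) := sameOff_moveTo v _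
    rw [huv] at h1
    exact h1.trans h2.symm
  have hr : fibreRank p q A u = fibreRank p q A v := by
    have := DFunLike.congr_fun huv q
    rwa [moveTo_apply hpq (fibreRank_le hA u), moveTo_apply hpq (fibreRank_le hA v)] at this
  rw [fibreRank_eq (fun _ _ _ => rfl : SameOff p q u u), fibreRank_eq hs] at hr
  exact injOn_rank (lt := fun a b : Fin n →₀ ℕ => a q < b q) (fun _ _ _ h h' => lt_trans h h')
    (fun _ => lt_irrefl _) (fibre_total hA u)
    (Finset.mem_filter.2 ⟨hu, fun _ _ _ => rfl⟩) (Finset.mem_filter.2 ⟨hv, hs⟩) hr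

theorem compress_subset (hpq : p ≠ q) (hA : A ⊆ monomialsOfDegree n d) :
    compress p q A ⊆ monomialsOfDegree n d := by
  classical
  exact fun w hw => ((mem_compress hpq hA).1 hw).1

theorem card_compress (hpq : p ≠ q) (hA : A ⊆ monomialsOfDegree n d) :
    (compress p q A).card = A.card := by
  classical
  exact Finset.card_image_of_injOn (injOn_moveTo_fibreRank hpq hA)

/-- A nonempty set of monomials in two variables has more products with the two variables than it
has elements; so compression does not enlarge the shadow. -/
theorem upShadow_compress_subset (hpq : p ≠ q) (hA : A ⊆ monomialsOfDegree n d) :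
    upShadow (compress p q A) ⊆ compress p q (upShadow A) := by
  classical
  intro w hw
  obtain ⟨u, hu, k, rfl⟩ := mem_upShadow.1 hw
  obtain ⟨hud, hlt⟩ := (mem_compress hpq hA).1 hu
  refine (mem_compress hpq (upShadow_subset hA)).2
    ⟨upShadow_subset (compress_subset hpq hA) hw, ?_⟩
  set F := A.filter fun v => SameOff p q u v with hF
  set G := (upShadow A).filter fun v => SameOff p q (u + Finsupp.single k 1) v with hG
  by_cases hk : k = q
  · have hne : F.Nonempty := Finset.card_pos.1 (by omega)
    obtain ⟨v, hv, hmax⟩ := F.exists_max_image (fun v => v q) hne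
    have hsub : insert (v + Finsupp.single q 1) (F.image fun v => v + Finsupp.single p 1) ⊆ G := by
      intro x hx
      rw [Finset.mem_insert, Finset.mem_image] at hx
      rw [hG, Finset.mem_filter]
      rcases hx with rfl | ⟨y, hy, rfl⟩
      · have hv := Finset.mem_filter.1 hv
        refine ⟨add_single_mem_upShadow hv.1 _, fun j hj hj' => ?_⟩
        simp [hv.2 j hj hj', hk]
      · have hy := Finset.mem_filter.1 hy
        refine ⟨add_single_mem_upShadow hy.1 _, fun j hj hj' => ?_⟩
        simp [hy.2 j hj hj', hk, Ne.symm hj, Ne.symm hj']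
    have hcard := Finset.card_le_card hsub
    rw [Finset.card_insert_of_notMem, Finset.card_image_of_injective _ (add_left_injective _)]
      at hcard
    · subst hk
      simp only [Finsupp.coe_add, Pi.add_apply, Finsupp.single_eq_same]
      omega
    · rw [Finset.mem_image]
      rintro ⟨y, hy, he⟩
      have h1 := hmax y hy
      have h2 := DFunLike.congr_fun he q
      simp only [Finsupp.coe_add, Pi.add_apply, Finsupp.single_eq_same, Finsupp.single_apply,
        if_neg hpq] at h2
      omega
  · have hsub : (F.image fun v => v + Finsupp.single k 1) ⊆ G := by
      intro x hx
      obtain ⟨y, hy, rfl⟩ := Finset.mem_image.1 hx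
      have hy := Finset.mem_filter.1 hy
      rw [hG, Finset.mem_filter]
      refine ⟨add_single_mem_upShadow hy.1 _, fun j hj hj' => ?_⟩
      simp [hy.2 j hj hj']
    have hcard := Finset.card_le_card hsub
    rw [Finset.card_image_of_injective _ (add_left_injective _)] at hcard
    simp only [Finsupp.coe_add, Pi.add_apply, Finsupp.single_apply, if_neg hk]
    omega

theorem card_upShadow_compress_le (hpq : p ≠ q) (hA : A ⊆ monomialsOfDegree n d) :
    (upShadow (compress p q A)).card ≤ (upShadow A).card :=
  (Finset.card_le_card (upShadow_compress_subset hpq hA)).trans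
    (card_compress hpq (upShadow_subset hA)).le

theorem sum_compress (hpq : p ≠ q) (hA : A ⊆ monomialsOfDegree n d) :
    ∑ u ∈ compress p q A, u q = ∑ u ∈ A, fibreRank p q A u := by
  classical
  rw [compress, Finset.sum_image (injOn_moveTo_fibreRank hpq hA)]
  exact Finset.sum_congr rfl fun u _ => moveTo_apply hpq (fibreRank_le hA u)

/-- If the rank of `u` in its fibre is its exponent of `x_q`, then all smaller exponents occur in
the fibre. -/
theorem exists_mem_of_fibreRank_eq (hA : A ⊆ monomialsOfDegree n d) {u : Fin n →₀ ℕ}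
    (h : fibreRank p q A u = u q) {b : ℕ} (hb : b < u q) :
    ∃ v ∈ A, SameOff p q u v ∧ v q = b := by
  classical
  have h1 : (A.filter fun v => SameOff p q u v ∧ v q < u q).image (fun v => v q) =
      Finset.range (u q) := by
    refine Finset.eq_of_subset_of_card_le (fun x hx => ?_) ?_
    · obtain ⟨v, hv, rfl⟩ := Finset.mem_image.1 hx
      simpa using (Finset.mem_filter.1 hv).2.2
    · rw [Finset.card_image_of_injOn, Finset.card_range]
      · exact h.ge
      intro v hv w hw hvw
      rw [Finset.mem_coe, Finset.mem_filter] at hv hw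
      refine (hv.2.1.symm.trans hw.2.1).eq ?_ hvw
      rw [mem_monomialsOfDegree.1 (hA hv.1), mem_monomialsOfDegree.1 (hA hw.1)]
  obtain ⟨v, hv, rfl⟩ := Finset.mem_image.1 (h1 ▸ Finset.mem_range.2 hb)
  have hv := Finset.mem_filter.1 hv
  exact ⟨v, hv.1, hv.2.1, rfl⟩

end Compression

/-- Repeated compression with respect to the pairs `x_i`, `x_{n+1}` lowers the total exponent of
`x_{n+1}` until the set is stable with respect to this variable. -/
theorem exists_isLastStable {n d : ℕ} (A : Finset (Fin (n + 1) →₀ ℕ))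
    (hA : A ⊆ monomialsOfDegree (n + 1) d) :
    ∃ B ⊆ monomialsOfDegree (n + 1) d, B.card = A.card ∧
      (upShadow B).card ≤ (upShadow A).card ∧ IsLastStable B := by
  induction hs : ∑ u ∈ A, u (Fin.last n) using Nat.strong_induction_on generalizing A with
  | _ s ih =>
    by_cases hst : IsLastStable A
    · exact ⟨A, hA, rfl, le_rfl, hst⟩
    · simp only [IsLastStable, not_forall] at hst
      obtain ⟨w, j, hw, i, hi⟩ := hst
      have hpq : i.castSucc ≠ Fin.last n := Fin.castSucc_ne_last i
      have hlt : ∑ u ∈ compress i.castSucc (Fin.last n) A, u (Fin.last n) < s := by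
        rw [sum_compress hpq hA, ← hs]
        refine Finset.sum_lt_sum (fun u _ => fibreRank_le hA u)
          ⟨_, hw, lt_of_le_of_ne (fibreRank_le hA _) fun he => hi ?_⟩
        obtain ⟨v, hv, hs, hvj⟩ := exists_mem_of_fibreRank_eq hA he (b := j) (by simp)
        convert hv
        refine SameOff.eq (p := i.castSucc) (q := Fin.last n) (fun k hk hk' => ?_) ?_ (by simp [hvj])
        · rw [← hs k hk hk']
          obtain ⟨k, rfl⟩ := Fin.exists_castSucc_eq.2 hk'
          have : i ≠ k := fun h => hk (h ▸ rfl)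
          simp [this]
        · have h1 := mem_monomialsOfDegree.1 (hA hw)
          rw [mem_monomialsOfDegree.1 (hA hv), ← h1]
          simp only [degree_snocMon, map_add, Finsupp.degree_single]
          omega
      obtain ⟨B, hB, hc, hu, hst⟩ := ih _ hlt _ (compress_subset hpq hA) rfl
      exact ⟨B, hB, hc.trans (card_compress hpq hA),
        hu.trans (card_upShadow_compress_le hpq hA), hst⟩

/-! ### Macaulay's theorem for sets of monomials -/

/-- In `n` variables, lex segments have the smallest upper shadows. -/
def LexShadowMinimal (n : ℕ) : Prop :=
  ∀ (d : ℕ) (A L : Finset (Fin n →₀ ℕ)), A ⊆ monomialsOfDegree n d → IsLexSeg d L →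
    L.card ≤ A.card → (upShadow L).card ≤ (upShadow A).card

theorem LexShadowMinimal.upShadow_subset {n d : ℕ} (hn : LexShadowMinimal n)
    {A B L M : Finset (Fin n →₀ ℕ)} (hA : A ⊆ monomialsOfDegree n d) (hAB : upShadow A ⊆ B)
    (hL : IsLexSeg d L) (hM : IsLexSeg (d + 1) M) (hLA : L.card ≤ A.card)
    (hBM : B.card ≤ M.card) : upShadow L ⊆ M :=
  hL.upShadow.subset_of_card_le hM
    ((hn d A L hA hL hLA).trans ((Finset.card_le_card hAB).trans hBM))

/-- A combinatorial form of the hyperplane restriction theorem: among the sets that are stable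
with respect to the last variable, lex segments have the fewest members free of it.

Otherwise, let `C_j` be the lex segments with the sizes of the slices `A_j`. By stability, products
of `C_j` with `j` variables lie in `C_0`, and some monomial `u` of `L_0` is missing from `C_0`.
If `w` is in `C_j`, then `w x_n^j` is in `C_0`, hence larger than `u`, which forces
`w x_{n+1}^j > u`. So `C_j ⊆ L_j` for all `j`, and `A` has fewer elements than `L`. -/
theorem card_slice_zero_le {n d : ℕ} (hn : LexShadowMinimal n) {A L : Finset (Fin (n + 1) →₀ ℕ)}
    (hA : A ⊆ monomialsOfDegree (n + 1) d) (hst : IsLastStable A) (hL : IsLexSeg d L)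
    (hLA : L.card ≤ A.card) : (slice L 0).card ≤ (slice A 0).card := by
  by_contra! hlt
  let C : ℕ → Finset (Fin n →₀ ℕ) := fun j =>
    largest LexGT (slice A j).card (monomialsOfDegree n (d - j))
  have hC : ∀ j, IsLexSeg (d - j) (C j) := fun j => isLexSeg_largest _ _ _
  have hCc : ∀ j, (C j).card = (slice A j).card := fun j =>
    card_largest_lexGT (Finset.card_le_card (slice_subset hA))
  have hstep : ∀ j, j + 1 ≤ d → upShadow (C (j + 1)) ⊆ C j := by
    intro j hj
    refine hn.upShadow_subset (A := slice A (j + 1)) (B := slice A j) (slice_subset hA) ?_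
      (hC (j + 1)) ?_ (hCc _).le (hCc _).ge
    · intro w hw
      obtain ⟨u, hu, i, rfl⟩ := mem_upShadow.1 hw
      exact mem_slice.2 (hst u j (mem_slice.1 hu) i)
    · rw [show d - (j + 1) + 1 = d - j by omega]
      exact hC j
  have hmul : ∀ j, j ≤ d → ∀ w ∈ C j, ∀ i : Fin n, w + Finsupp.single i j ∈ C 0 := by
    intro j
    induction j with
    | zero => exact fun _ w hw i => by simpa using hw
    | succ j ih =>
      intro hj w hw i
      have := ih (by omega) _ (hstep j hj (add_single_mem_upShadow hw i)) i
      rwa [add_assoc, ← Finsupp.single_add, add_comm 1 j] at this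
  have hL0 : IsLexSeg (d - 0) (slice L 0) := hL.slice (Nat.zero_le d)
  obtain ⟨u, hu, hu'⟩ : ∃ u ∈ slice L 0, u ∉ C 0 := by
    by_contra! hc
    have := Finset.card_le_card (show slice L 0 ⊆ C 0 from hc)
    rw [hCc] at this
    omega
  have hud := mem_monomialsOfDegree.1 (hL0.subset hu)
  have hsub : ∀ j, j ≤ d → C j ⊆ slice L j := by
    intro j hj w hw
    have hwd := mem_monomialsOfDegree.1 ((hC j).subset hw)
    have hgt : LexGT w u := by
      rcases lexGT_trichotomy w u with h | h | h
      · exact h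
      · subst h
        obtain rfl : j = 0 := by omega
        exact absurd hw hu'
      · exfalso
        cases n with
        | zero =>
          obtain ⟨i, -⟩ := lexGT_iff.1 h
          exact i.elim0
        | succ n =>
          have hy := hmul j hj w hw (Fin.last n)
          have hyd := mem_monomialsOfDegree.1 ((hC 0).subset hy)
          obtain ⟨i, hi, hlt⟩ := lexGT_iff.1 h
          induction i using Fin.lastCases with
          | last =>
            refine hu' ((eq_of_initMon_eq ?_ (hyd.trans hud.symm)) ▸ hy)
            rw [initMon_add_single_last]
            ext k
            simpa using hi k.castSucc (Fin.castSucc_lt_last k)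
          | cast i =>
            refine hu' ((hC 0).upward _ hy u (mem_monomialsOfDegree.2 hud) ?_)
            have hne : ∀ k ≤ i.castSucc, Fin.last n ≠ k := fun k hk =>
              (lt_of_le_of_lt hk (Fin.castSucc_lt_last i)).ne'
            refine lexGT_iff.2 ⟨i.castSucc, fun k hk => ?_, ?_⟩
            · simpa [Finsupp.single_apply, hne k hk.le] using hi k hk
            · simpa [Finsupp.single_apply, hne _ le_rfl] using hlt
    refine mem_slice.2 (hL.upward _ (mem_slice.1 hu) _ (mem_monomialsOfDegree.2 ?_)
      (lexGT_snocMon_of_lexGT hgt j 0))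
    rw [degree_snocMon, hwd]
    omega
  rw [card_eq_sum_card_slice hA, card_eq_sum_card_slice hL.subset] at hLA
  refine hLA.not_gt (Finset.sum_lt_sum (fun j hj => ?_) ⟨0, by simp, hlt⟩)
  rw [← hCc]
  exact Finset.card_le_card (hsub j (by simpa [Nat.lt_succ_iff] using hj))

theorem lexShadowMinimal (n : ℕ) : LexShadowMinimal n := by
  induction n with
  | zero =>
    intro d A L _ _ _
    have : upShadow L = ∅ := by
      refine Finset.eq_empty_of_forall_notMem fun w hw => ?_
      obtain ⟨-, -, i, -⟩ := mem_upShadow.1 hw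
      exact i.elim0
    simp [this]
  | succ n ih =>
    intro d A L hA hL hLA
    obtain ⟨B, hB, hBc, hBu, hst⟩ := exists_isLastStable A hA
    rw [← hBc] at hLA
    have h0 := card_slice_zero_le ih hB hst hL hLA
    have h1 := ih _ _ _ (slice_subset hB) (hL.slice (Nat.zero_le d)) h0
    have h2 := hL.isLastStable.card_upShadow_le
    have h3 := card_add_card_upShadow_slice_le B
    omega

/-! ### Hilbert functions and standard monomials -/

open Classical in
/-- Going through a finite family in increasing order, the vectors that are not combinations of
earlier ones form a basis of the span. -/
theorem finrank_span_image_eq_card {K V α β : Type*} [Field K] [AddCommGroup V] [Module K V]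
    [LinearOrder β] {f : α → β} (hf : Function.Injective f) (v : α → V) (S : Finset α) :
    Module.finrank K (Submodule.span K (v '' S)) =
      (S.filter fun u => v u ∉ Submodule.span K (v '' {w | w ∈ S ∧ f w < f u})).card := by
  have key : LinearIndepOn K v
      (S.filter fun u => v u ∉ Submodule.span K (v '' {w | w ∈ S ∧ f w < f u}) : Finset α) ∧
      Submodule.span K (v '' S) = Submodule.span K (v ''
      (S.filter fun u => v u ∉ Submodule.span K (v '' {w | w ∈ S ∧ f w < f u}) : Finset α)) := by
    induction S using Finset.induction_on_max_value f with
    | empty => simp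
    | insert a S ha hmax ih =>
      have hlt : ∀ x ∈ S, f x < f a := fun x hx =>
        lt_of_le_of_ne (hmax x hx) fun h => ha (hf h ▸ hx)
      have h1 : {w | w ∈ insert a S ∧ f w < f a} = (S : Set α) := by
        ext w
        simp only [Finset.mem_insert, Set.mem_ofPred_eq, Finset.mem_coe]
        constructor
        · rintro ⟨rfl | h, h'⟩
          · exact absurd h' (lt_irrefl _)
          · exact h
        · exact fun h => ⟨Or.inr h, hlt w h⟩
      have h2 : ∀ u ∈ S, {w | w ∈ insert a S ∧ f w < f u} = {w | w ∈ S ∧ f w < f u} := by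
        intro u hu
        ext w
        simp only [Finset.mem_insert, Set.mem_ofPred_eq]
        constructor
        · rintro ⟨rfl | h, h'⟩
          · exact absurd h' (hlt u hu).not_gt
          · exact ⟨h, h'⟩
        · exact fun h => ⟨Or.inr h.1, h.2⟩
      rw [Finset.filter_insert, h1, Finset.filter_congr fun u hu => by rw [h2 u hu]]
      split_ifs with h
      · refine ⟨ih.1, ?_⟩
        rw [Finset.coe_insert, Set.image_insert_eq, Submodule.span_insert_eq_span h, ih.2]
      · rw [Finset.coe_insert, Finset.coe_insert, Set.image_insert_eq, Set.image_insert_eq]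
        refine ⟨ih.1.insert (ih.2 ▸ h), ?_⟩
        rw [Submodule.span_insert, Submodule.span_insert, ih.2]
  rw [key.2]
  set B := S.filter fun u => v u ∉ Submodule.span K (v '' {w | w ∈ S ∧ f w < f u})
  have h3 := finrank_span_eq_card (R := K) (b := fun x : (B : Set α) => v x) key.1
  rw [Set.image_eq_range]
  rw [h3]
  simp

section

variable {K : Type*} [Field K] {n : ℕ}

theorem homogeneousSubmodule_eq_span_monomials (d : ℕ) :
    homogeneousSubmodule (Fin n) K d =
      Submodule.span K ((fun u => monomial u (1 : K)) '' (monomialsOfDegree n d : Set _)) := by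
  refine le_antisymm (fun f hf => ?_) (Submodule.span_le.2 ?_)
  · rw [f.as_sum]
    refine Submodule.sum_mem _ fun u hu => ?_
    have : monomial u (coeff u f) = coeff u f • monomial u (1 : K) := by
      simp [smul_monomial]
    rw [this]
    refine Submodule.smul_mem _ _ (Submodule.subset_span ⟨u, ?_, rfl⟩)
    have hf : f.IsHomogeneous d := hf
    rw [Finset.mem_coe, mem_monomialsOfDegree]
    by_contra hc
    exact mem_support_iff.1 hu (hf.coeff_eq_zero hc)
  · rintro _ ⟨u, hu, rfl⟩
    exact isHomogeneous_monomial _ (mem_monomialsOfDegree.1 hu)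

theorem gradedPiece_eq_span (I : Ideal (MvPolynomial (Fin n) K)) (d : ℕ) :
    gradedPiece I d = Submodule.span K
      ((fun u => Ideal.Quotient.mkₐ K I (monomial u (1 : K))) '' (monomialsOfDegree n d : Set _)) := by
  rw [gradedPiece, homogeneousSubmodule_eq_span_monomials, Submodule.map_span, Set.image_image]
  rfl

instance finiteDimensional_gradedPiece (I : Ideal (MvPolynomial (Fin n) K)) (d : ℕ) :
    FiniteDimensional K (gradedPiece I d) := by
  rw [gradedPiece_eq_span]
  exact FiniteDimensional.span_of_finite K ((Finset.finite_toSet _).image _)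

theorem mem_gradedPiece {I : Ideal (MvPolynomial (Fin n) K)} {d : ℕ}
    {a : MvPolynomial (Fin n) K ⧸ I} :
    a ∈ gradedPiece I d ↔ ∃ f : MvPolynomial (Fin n) K, f.IsHomogeneous d ∧
      Ideal.Quotient.mk I f = a :=
  Iff.rfl

/-- The standard monomials of `I` (with respect to the lex order): those whose residue class is
not a combination of the classes of smaller monomials of the same degree. -/
def stdMonomials (I : Ideal (MvPolynomial (Fin n) K)) : Set (Fin n →₀ ℕ) :=
  {u | Ideal.Quotient.mkₐ K I (monomial u (1 : K)) ∉ Submodule.span K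
    ((fun w => Ideal.Quotient.mkₐ K I (monomial w (1 : K))) ''
      {w | w ∈ monomialsOfDegree n u.degree ∧ LexGT u w})}

open Classical in
theorem hilbertFunction_eq_card (I : Ideal (MvPolynomial (Fin n) K)) (d : ℕ) :
    hilbertFunction I d = ((monomialsOfDegree n d).filter (· ∈ stdMonomials I)).card := by
  have h := finrank_span_image_eq_card (K := K) (f := fun u : Fin n →₀ ℕ => toLex u)
    toLex.injective (fun u => Ideal.Quotient.mkₐ K I (monomial u (1 : K))) (monomialsOfDegree n d)
  rw [hilbertFunction, gradedPiece_eq_span]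
  refine h.trans (congrArg Finset.card (Finset.filter_congr fun u hu => ?_))
  rw [stdMonomials, Set.mem_ofPred_eq, mem_monomialsOfDegree.1 hu]
  rfl

theorem isLowerSet_stdMonomials (I : Ideal (MvPolynomial (Fin n) K)) :
    IsLowerSet (stdMonomials I) := by
  intro u' u hle hu' hu
  refine hu' ?_
  obtain ⟨c, rfl⟩ := exists_add_of_le hle
  have hmul : ∀ w : Fin n →₀ ℕ, Ideal.Quotient.mkₐ K I (monomial (w + c) (1 : K)) =
      LinearMap.mulLeft K (Ideal.Quotient.mkₐ K I (monomial c (1 : K)))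
        (Ideal.Quotient.mkₐ K I (monomial w (1 : K))) := by
    intro w
    rw [LinearMap.mulLeft_apply, ← map_mul, monomial_mul, add_comm, one_mul]
  rw [hmul]
  have := Submodule.mem_map_of_mem
    (f := LinearMap.mulLeft K (Ideal.Quotient.mkₐ K I (monomial c (1 : K)))) hu
  rw [Submodule.map_span, Set.image_image] at this
  refine Submodule.span_mono ?_ this
  rintro _ ⟨w, ⟨hw, hlt⟩, rfl⟩
  refine ⟨w + c, ⟨?_, hlt.add_right c⟩, hmul w⟩
  rw [mem_monomialsOfDegree] at hw ⊢
  rw [map_add, map_add, hw]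

theorem hilbertFunction_eq_zero_of_le {I : Ideal (MvPolynomial (Fin n) K)} {d e : ℕ}
    (hd : hilbertFunction I d = 0) (hde : d ≤ e) : hilbertFunction I e = 0 := by
  classical
  rw [hilbertFunction_eq_card, Finset.card_eq_zero, Finset.filter_eq_empty_iff] at hd ⊢
  intro u hu hstd
  obtain ⟨v, hv, hvd⟩ := Finsupp.exists_le_degree_eq u d
    (hde.trans (mem_monomialsOfDegree.1 hu).ge)
  exact hd (mem_monomialsOfDegree.2 hvd) (isLowerSet_stdMonomials I hv hstd)

theorem hilbertFunction_eq_zero_iff {I : Ideal (MvPolynomial (Fin n) K)} {d : ℕ} :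
    hilbertFunction I d = 0 ↔ ∀ f : MvPolynomial (Fin n) K, f.IsHomogeneous d → f ∈ I := by
  rw [hilbertFunction, Submodule.finrank_eq_zero, Submodule.eq_bot_iff]
  simp only [mem_gradedPiece, forall_exists_index, and_imp, forall_apply_eq_imp_iff₂]
  exact forall₂_congr fun f _ => Ideal.Quotient.eq_zero_iff_mem

theorem monomialsOfDegree_zero : monomialsOfDegree n 0 = {0} := by
  ext u
  simp [mem_monomialsOfDegree, Finsupp.degree_eq_zero_iff]

theorem hilbertFunction_zero {I : Ideal (MvPolynomial (Fin n) K)} (hI : I ≠ ⊤) :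
    hilbertFunction I 0 = 1 := by
  have h1 : hilbertFunction I 0 ≤ 1 := by
    classical
    rw [hilbertFunction_eq_card]
    refine (Finset.card_filter_le _ _).trans ?_
    simp [monomialsOfDegree_zero]
  have h2 : hilbertFunction I 0 ≠ 0 := fun h =>
    hI ((Ideal.eq_top_iff_one I).2 (hilbertFunction_eq_zero_iff.1 h 1 (isHomogeneous_one _ _)))
  omega

/-- The Hilbert function of an Artinian graded quotient vanishes in large degrees: the powers of
the maximal ideal become stationary in the quotient, and they differ in each degree in which it
is nonzero. -/
theorem exists_hilbertFunction_eq_zero {I : Ideal (MvPolynomial (Fin n) K)} (hI : IsHomogIdeal I)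
    [IsArtinianRing (MvPolynomial (Fin n) K ⧸ I)] : ∃ s, ∀ d, s < d → hilbertFunction I d = 0 := by
  let J : ℕ →o (Submodule (MvPolynomial (Fin n) K ⧸ I) (MvPolynomial (Fin n) K ⧸ I))ᵒᵈ :=
    { toFun := fun d => OrderDual.toDual ((idealOfVars (Fin n) K ^ d).map (Ideal.Quotient.mk I))
      monotone' := fun a b hab => OrderDual.toDual_le_toDual.2
        (Ideal.map_mono (Ideal.pow_le_pow_right hab)) }
  obtain ⟨s, hs⟩ := IsArtinian.monotone_stabilizes J
  refine ⟨s, fun d hd => hilbertFunction_eq_zero_iff.2 fun f hf => ?_⟩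
  have h1 : (idealOfVars (Fin n) K ^ d).map (Ideal.Quotient.mk I) =
      (idealOfVars (Fin n) K ^ (d + 1)).map (Ideal.Quotient.mk I) :=
    (hs d hd.le).symm.trans (hs (d + 1) (by omega))
  have h2 : f ∈ idealOfVars (Fin n) K ^ d := by
    rw [mem_pow_idealOfVars_iff']
    exact fun u hu => hf.coeff_eq_zero hu.ne
  have h3 := h1 ▸ Ideal.mem_map_of_mem (Ideal.Quotient.mk I) h2
  rw [Ideal.mem_map_iff_of_surjective _ Ideal.Quotient.mk_surjective] at h3
  obtain ⟨g, hg, hgf⟩ := h3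
  have h4 := homogeneousComponent_mem_of_mem hI (Ideal.Quotient.eq.1 hgf) d
  rw [map_sub, homogeneousComponent_eq_self hf] at h4
  have h5 : homogeneousComponent d g = 0 := by
    ext u
    rw [coeff_homogeneousComponent, coeff_zero]
    split_ifs with hu
    · exact (mem_pow_idealOfVars_iff' _ _).1 hg u (by omega)
    · rfl
  rw [h5, zero_sub, neg_mem_iff] at h4
  exact h4

theorem isArtinianRing_of_hilbertFunction_eq_zero {I : Ideal (MvPolynomial (Fin n) K)}
    (h : ∃ s, ∀ d, s < d → hilbertFunction I d = 0) :
    IsArtinianRing (MvPolynomial (Fin n) K ⧸ I) := by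
  obtain ⟨s, hs⟩ := h
  have htop : (⊤ : Submodule K (MvPolynomial (Fin n) K ⧸ I)) =
      Submodule.span K ((fun u => Ideal.Quotient.mkₐ K I (monomial u (1 : K))) ''
        {u | u.degree ≤ s}) := by
    refine (eq_top_iff.2 fun a _ => ?_).symm
    obtain ⟨f, rfl⟩ := Ideal.Quotient.mkₐ_surjective K I a
    rw [f.as_sum, map_sum]
    refine Submodule.sum_mem _ fun u _ => ?_
    have h1 : monomial u (coeff u f) = coeff u f • monomial u (1 : K) := by simp [smul_monomial]
    rw [h1, map_smul]
    refine Submodule.smul_mem _ _ ?_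
    by_cases hu : u.degree ≤ s
    · exact Submodule.subset_span ⟨u, hu, rfl⟩
    · have h2 : Ideal.Quotient.mkₐ K I (monomial u (1 : K)) = 0 :=
        Ideal.Quotient.eq_zero_iff_mem.2 (hilbertFunction_eq_zero_iff.1 (hs _ (not_le.1 hu)) _
          (isHomogeneous_monomial _ rfl))
      rw [h2]
      exact zero_mem _
  have : Module.Finite K (MvPolynomial (Fin n) K ⧸ I) := by
    refine Module.finite_def.2 ?_
    rw [htop]
    exact Submodule.fg_span ((Finsupp.finite_of_degree_le s).image _)
  exact IsArtinianRing.of_finite K _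

/-! ### Monomial ideals -/

theorem mem_monomialIdeal {S : Set (Fin n →₀ ℕ)} {f : MvPolynomial (Fin n) K} :
    f ∈ monomialIdeal K S ↔ ∀ u ∈ f.support, ∃ s ∈ S, s ≤ u :=
  mem_ideal_span_monomial_image

theorem monomial_mem_monomialIdeal {S : Set (Fin n →₀ ℕ)} {u : Fin n →₀ ℕ} :
    monomial u (1 : K) ∈ monomialIdeal K S ↔ ∃ s ∈ S, s ≤ u := by
  classical
  rw [mem_monomialIdeal, support_monomial, if_neg one_ne_zero]
  simp

theorem monomial_mem_monomialIdeal_of_isUpperSet {S : Set (Fin n →₀ ℕ)} (hS : IsUpperSet S)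
    {u : Fin n →₀ ℕ} : monomial u (1 : K) ∈ monomialIdeal K S ↔ u ∈ S :=
  monomial_mem_monomialIdeal.trans ⟨fun ⟨_, hs, hle⟩ => hS hle hs, fun h => ⟨u, h, le_rfl⟩⟩

theorem mem_monomialIdeal_iff_monomial_mem {S : Set (Fin n →₀ ℕ)} {f : MvPolynomial (Fin n) K} :
    f ∈ monomialIdeal K S ↔ ∀ u ∈ f.support, monomial u (1 : K) ∈ monomialIdeal K S := by
  rw [mem_monomialIdeal]
  exact forall₂_congr fun u _ => monomial_mem_monomialIdeal.symm

theorem monomialIdeal_mono {S T : Set (Fin n →₀ ℕ)} (h : S ⊆ T) :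
    monomialIdeal K S ≤ monomialIdeal K T :=
  Ideal.span_mono (Set.image_mono h)

theorem monomialIdeal_union (S T : Set (Fin n →₀ ℕ)) :
    monomialIdeal K (S ∪ T) = monomialIdeal K S ⊔ monomialIdeal K T := by
  rw [monomialIdeal, Set.image_union, Ideal.span_union]
  rfl

theorem monomialIdeal_iUnion {ι : Type*} (S : ι → Set (Fin n →₀ ℕ)) :
    monomialIdeal K (⋃ i, S i) = ⨆ i, monomialIdeal K (S i) := by
  rw [monomialIdeal, Set.image_iUnion, Ideal.span_iUnion]
  rfl

theorem isHomogIdeal_monomialIdeal (S : Set (Fin n →₀ ℕ)) : IsHomogIdeal (monomialIdeal K S) := by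
  refine Ideal.homogeneous_span _ _ ?_
  rintro _ ⟨u, -, rfl⟩
  exact ⟨u.degree, isHomogeneous_monomial _ rfl⟩

theorem stdMonomials_monomialIdeal (S : Set (Fin n →₀ ℕ)) :
    stdMonomials (monomialIdeal K S) = {u | monomial u (1 : K) ∉ monomialIdeal K S} := by
  ext u
  refine not_congr ⟨fun h => ?_, fun h => ?_⟩
  · have h1 : (fun w => Ideal.Quotient.mkₐ K (monomialIdeal K S) (monomial w (1 : K))) ''
        {w | w ∈ monomialsOfDegree n u.degree ∧ LexGT u w} =
        (Ideal.Quotient.mkₐ K (monomialIdeal K S)).toLinearMap '' ((fun w => monomial w (1 : K)) ''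
          {w | w ∈ monomialsOfDegree n u.degree ∧ LexGT u w}) := by
      rw [Set.image_image]
      rfl
    rw [h1, ← Submodule.map_span] at h
    obtain ⟨g, hg, hgu⟩ := h
    have hcoeff : coeff u g = 0 := by
      have hle : Submodule.span K ((fun w => monomial w (1 : K)) ''
          {w | w ∈ monomialsOfDegree n u.degree ∧ LexGT u w}) ≤
          LinearMap.ker (lcoeff K u) := by
        refine Submodule.span_le.2 ?_
        rintro _ ⟨w, ⟨-, hlt⟩, rfl⟩
        have : w ≠ u := fun h => LexGT.irrefl u (h ▸ hlt)
        classical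
        simp [coeff_monomial, this]
      simpa using hle hg
    have hmem : g - monomial u (1 : K) ∈ monomialIdeal K S := Ideal.Quotient.eq.1 hgu
    rw [mem_monomialIdeal_iff_monomial_mem] at hmem
    refine hmem u ?_
    rw [mem_support_iff, coeff_sub, hcoeff]
    simp
  · rw [show Ideal.Quotient.mkₐ K (monomialIdeal K S) (monomial u (1 : K)) = 0 from
      Ideal.Quotient.eq_zero_iff_mem.2 h]
    exact zero_mem _

theorem hilbertFunction_monomialIdeal (S : Set (Fin n →₀ ℕ)) (d : ℕ) :
    hilbertFunction (monomialIdeal K S) d = (missingMonomials (monomialIdeal K S) d).card := by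
  classical
  rw [hilbertFunction_eq_card, stdMonomials_monomialIdeal, missingMonomials]
  congr

theorem mem_missingMonomials {I : Ideal (MvPolynomial (Fin n) K)} {d : ℕ} {u : Fin n →₀ ℕ} :
    u ∈ missingMonomials I d ↔ u.degree = d ∧ monomial u (1 : K) ∉ I := by
  classical
  rw [missingMonomials, Finset.mem_filter, mem_monomialsOfDegree]

/-! ### The weak Lefschetz property in terms of polynomials -/

theorem isWeakLefschetzElement_iff {I : Ideal (MvPolynomial (Fin n) K)}
    {l : MvPolynomial (Fin n) K} :
    IsWeakLefschetzElement I l ↔ l.IsHomogeneous 1 ∧ ∀ d : ℕ, 1 ≤ d →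
      (∀ f : MvPolynomial (Fin n) K, f.IsHomogeneous d → l * f ∈ I → f ∈ I) ∨
      (∀ g : MvPolynomial (Fin n) K, g.IsHomogeneous (d + 1) →
        ∃ f : MvPolynomial (Fin n) K, f.IsHomogeneous d ∧ l * f - g ∈ I) := by
  refine and_congr_right fun _ => forall₂_congr fun d _ => or_congr ?_ ?_
  · simp only [mem_gradedPiece, forall_exists_index, and_imp, forall_apply_eq_imp_iff₂, ← map_mul,
      Ideal.Quotient.eq_zero_iff_mem]
  · simp only [mem_gradedPiece, forall_exists_index, and_imp, forall_apply_eq_imp_iff₂]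
    refine forall₂_congr fun g _ => ⟨?_, ?_⟩
    · rintro ⟨_, ⟨f, hf, rfl⟩, h⟩
      exact ⟨f, hf, Ideal.Quotient.eq.1 (by rw [map_mul, h])⟩
    · rintro ⟨f, hf, h⟩
      exact ⟨_, ⟨f, hf, rfl⟩, by rw [← map_mul]; exact Ideal.Quotient.eq.2 h⟩

end

/-! ### Lex ideals -/

theorem isUpperSet_of_add_single_mem {n : ℕ} {S : Set (Fin n →₀ ℕ)}
    (h : ∀ u ∈ S, ∀ i, u + Finsupp.single i 1 ∈ S) : IsUpperSet S := by
  intro u w hle hu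
  obtain ⟨c, rfl⟩ := exists_add_of_le hle
  clear hle
  induction c using Finsupp.induction_linear generalizing u with
  | zero => simpa using hu
  | add f g hf hg => rw [← add_assoc]; exact hg (hf hu)
  | single i b =>
    induction b with
    | zero => simpa using hu
    | succ b ih => rw [Finsupp.single_add, ← add_assoc]; exact h _ ih i

theorem degree_sub_single_add_single {n : ℕ} {u : Fin n →₀ ℕ} {k : Fin n} (hk : 0 < u k)
    (i : Fin n) : (u - Finsupp.single k 1 + Finsupp.single i 1).degree = u.degree := by
  have hle : Finsupp.single k 1 ≤ u := by simpa using Nat.succ_le_iff.2 hk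
  have h1 := congrArg Finsupp.degree (tsub_add_cancel_of_le hle)
  simpa only [map_add, Finsupp.degree_single] using h1

/-- An O-sequence counts the elements of an order ideal of monomials in `h_1` variables: the
standard monomials only involve the variables that are standard themselves. -/
theorem IsOSequence.exists_isLowerSet {K : Type*} [Field K] {h : ℕ → ℕ} (hh : IsOSequence K h) :
    ∃ G : Set (Fin (h 1) →₀ ℕ), IsLowerSet G ∧
      ∀ d, h d = (open Classical in ((monomialsOfDegree (h 1) d).filter (· ∈ G)).card) := by
  classical
  obtain ⟨N, I, -, -, hI⟩ := hh
  have hlow := isLowerSet_stdMonomials I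
  set V : Finset (Fin N) := Finset.univ.filter fun i => Finsupp.single i 1 ∈ stdMonomials I with hV
  have hVc : V.card = h 1 := by
    rw [← hI 1, hilbertFunction_eq_card,
      ← Finset.card_image_of_injective V (Finsupp.single_left_injective (one_ne_zero (α := ℕ)))]
    congr 1
    ext u
    simp only [hV, Finset.mem_image, Finset.mem_filter, Finset.mem_univ, true_and,
      mem_monomialsOfDegree]
    constructor
    · rintro ⟨i, hi, rfl⟩
      exact ⟨by simp, hi⟩
    · rintro ⟨hd, hu⟩
      obtain ⟨i, rfl⟩ : u ∈ Set.range fun i : Fin N => Finsupp.single i 1 := by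
        rw [Finsupp.range_single_one]; exact hd
      exact ⟨i, hu, rfl⟩
  let e := V.orderEmbOfFin hVc
  have he : Function.Injective e := e.injective
  refine ⟨{u | u.mapDomain e ∈ stdMonomials I},
    fun u v hvu hu => hlow (Finsupp.mapDomain_mono hvu) hu, fun d => ?_⟩
  rw [← hI d, hilbertFunction_eq_card,
    ← Finset.card_image_of_injective _ (Finsupp.mapDomain_injective he)]
  congr 1
  ext w
  simp only [Finset.mem_image, Finset.mem_filter, mem_monomialsOfDegree, Set.mem_ofPred_eq]
  constructor
  · rintro ⟨hd, hw⟩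
    have hsupp : (w.support : Set (Fin N)) ⊆ Set.range e := by
      intro i hi
      rw [Finset.range_orderEmbOfFin, Finset.mem_coe, hV, Finset.mem_filter]
      refine ⟨Finset.mem_univ i, hlow ?_ hw⟩
      simpa [Nat.one_le_iff_ne_zero] using hi
    have h1 := Finsupp.mapDomain_comapDomain e he w hsupp
    refine ⟨_, ⟨?_, ?_⟩, h1⟩
    · rw [← hd, ← h1, Finsupp.degree_mapDomain, h1]
    · rwa [h1]
  · rintro ⟨u, ⟨hd, hu⟩, rfl⟩
    exact ⟨by rw [Finsupp.degree_mapDomain, hd], hu⟩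

section

variable {K : Type*} [Field K] {h : ℕ → ℕ}

/-- Macaulay's theorem: the lex segments belonging to an O-sequence `h` form an ideal. -/
theorem IsOSequence.isUpperSet_iUnion_largest (hh : IsOSequence K h) :
    IsUpperSet (⋃ d, (largest LexGT ((monomialsOfDegree (h 1) d).card - h d)
      (monomialsOfDegree (h 1) d) : Set (Fin (h 1) →₀ ℕ))) := by
  classical
  obtain ⟨G, hG, hGc⟩ := hh.exists_isLowerSet
  refine isUpperSet_of_add_single_mem fun u hu i => ?_
  obtain ⟨d, hu⟩ := Set.mem_iUnion.1 hu
  refine Set.mem_iUnion.2 ⟨d + 1, ?_⟩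
  have hc : ∀ d, ((monomialsOfDegree (h 1) d).filter (· ∉ G)).card =
      (monomialsOfDegree (h 1) d).card - h d := fun d => by
    have := Finset.card_filter_add_card_filter_not (s := monomialsOfDegree (h 1) d) (· ∈ G)
    have h2 : h d = ((monomialsOfDegree (h 1) d).filter (· ∈ G)).card := hGc d
    omega
  have h1 : ∀ d, (largest LexGT ((monomialsOfDegree (h 1) d).card - h d)
      (monomialsOfDegree (h 1) d)).card = (monomialsOfDegree (h 1) d).card - h d := fun d =>
    card_largest_lexGT (Nat.sub_le _ _)
  refine (lexShadowMinimal (h 1)).upShadow_subset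
    (A := (monomialsOfDegree (h 1) d).filter (· ∉ G))
    (B := (monomialsOfDegree (h 1) (d + 1)).filter (· ∉ G))
    (Finset.filter_subset _ _) (fun w hw => ?_) (isLexSeg_largest _ d _) (isLexSeg_largest _ _ _)
    ?_ ?_ (add_single_mem_upShadow hu i)
  · refine Finset.mem_filter.2 ⟨upShadow_subset (Finset.filter_subset _ _) hw, ?_⟩
    obtain ⟨v, hv, j, rfl⟩ := mem_upShadow.1 hw
    exact fun hc => (Finset.mem_filter.1 hv).2 (hG (by simp) hc)
  · rw [hc, h1]
  · rw [hc, h1]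

theorem IsOSequence.hilbertFunction_lexIdeal (hh : IsOSequence K h) (d : ℕ) :
    hilbertFunction (lexIdeal K (h 1) h) d = h d := by
  classical
  have h1 : missingMonomials (lexIdeal K (h 1) h) d = monomialsOfDegree (h 1) d \
      largest LexGT ((monomialsOfDegree (h 1) d).card - h d) (monomialsOfDegree (h 1) d) := by
    ext u
    rw [mem_missingMonomials, lexIdeal,
      monomial_mem_monomialIdeal_of_isUpperSet hh.isUpperSet_iUnion_largest, Finset.mem_sdiff,
      mem_monomialsOfDegree, Set.mem_iUnion]
    refine and_congr_right fun hd => not_congr ⟨?_, fun h => ⟨d, h⟩⟩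
    rintro ⟨e, he⟩
    have := mem_monomialsOfDegree.1 ((isLexSeg_largest _ _ _).subset he)
    rw [← hd, this]
    exact he
  have hle : h d ≤ (monomialsOfDegree (h 1) d).card := by
    obtain ⟨G, -, hG⟩ := hh.exists_isLowerSet
    rw [hG d]
    exact Finset.card_filter_le _ _
  rw [lexIdeal, hilbertFunction_monomialIdeal, ← lexIdeal, h1,
    Finset.card_sdiff_of_subset (isLexSeg_largest _ _ _).subset,
    card_largest_lexGT (Nat.sub_le _ _)]
  omega

theorem IsOSequence.isStronglyStable_lexIdeal (hh : IsOSequence K h) :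
    IsStronglyStable (lexIdeal K (h 1) h) := by
  refine ⟨⟨_, rfl⟩, fun u hu i k hik hk => ?_⟩
  rw [lexIdeal, monomial_mem_monomialIdeal_of_isUpperSet hh.isUpperSet_iUnion_largest,
    Set.mem_iUnion] at hu ⊢
  obtain ⟨d, hu⟩ := hu
  have hs := isLexSeg_largest (h 1) d ((monomialsOfDegree (h 1) d).card - h d)
  have hd := mem_monomialsOfDegree.1 (hs.subset hu)
  refine ⟨d, hs.upward u hu _ (mem_monomialsOfDegree.2 ?_) (lexGT_iff.2 ⟨i, fun j hj => ?_, ?_⟩)⟩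
  · rw [degree_sub_single_add_single hk, hd]
  · simp [hj.ne', (hj.trans hik).ne']
  · simp [hik.ne']

end

/-! ### The degree reverse lexicographic order -/

theorem revLexGT_iff_toColex_lt {n : ℕ} {u v : Fin n →₀ ℕ} :
    RevLexGT u v ↔ toColex u < toColex v := by
  rw [Finsupp.Colex.lt_iff]
  exact ⟨fun ⟨i, h, h'⟩ => ⟨i, h', h⟩, fun ⟨i, h, h'⟩ => ⟨i, h', h⟩⟩

theorem revLexGT_trichotomy {n : ℕ} (u v : Fin n →₀ ℕ) :
    RevLexGT u v ∨ u = v ∨ RevLexGT v u := by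
  rw [revLexGT_iff_toColex_lt, revLexGT_iff_toColex_lt]
  rcases lt_trichotomy (toColex u) (toColex v) with h | h | h
  exacts [Or.inl h, Or.inr (Or.inl (toColex.injective h)), Or.inr (Or.inr h)]

theorem RevLexGT.trans {n : ℕ} {u v w : Fin n →₀ ℕ} (h : RevLexGT u v) (h' : RevLexGT v w) :
    RevLexGT u w :=
  revLexGT_iff_toColex_lt.2
    ((revLexGT_iff_toColex_lt.1 h).trans (revLexGT_iff_toColex_lt.1 h'))

theorem RevLexGT.irrefl {n : ℕ} (u : Fin n →₀ ℕ) : ¬ RevLexGT u u := fun h =>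
  lt_irrefl _ (revLexGT_iff_toColex_lt.1 h)

theorem revLexGT_snocMon_iff {n : ℕ} {u v : Fin n →₀ ℕ} {a b : ℕ} :
    RevLexGT (snocMon u a) (snocMon v b) ↔ a < b ∨ a = b ∧ RevLexGT u v := by
  constructor
  · rintro ⟨i, hi, hj⟩
    induction i using Fin.lastCases with
    | last => exact Or.inl (by simpa using hi)
    | cast i =>
      refine Or.inr ⟨by simpa using hj (Fin.last n) (Fin.castSucc_lt_last i), i, by simpa using hi,
        fun j hij => by simpa using hj j.castSucc (by simpa using hij)⟩
  · rintro (h | ⟨rfl, i, hi, hj⟩)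
    · exact ⟨Fin.last n, by simpa using h, fun j hj => absurd (Fin.le_last j) hj.not_ge⟩
    · refine ⟨i.castSucc, by simpa using hi, fun j hij => ?_⟩
      induction j using Fin.lastCases with
      | last => simp
      | cast j => simpa using hj j (by simpa using hij)

/-- `u > v` in the degree reverse lexicographic order, for monomials of arbitrary degrees. If `u`
and `v` are made monomials of the same degree by multiplying with powers of a further last
variable, this becomes the reverse lexicographic order. -/
def DegRevLexGT {n : ℕ} (u v : Fin n →₀ ℕ) : Prop :=
  v.degree < u.degree ∨ v.degree = u.degree ∧ RevLexGT u v

theorem DegRevLexGT.trans {n : ℕ} {u v w : Fin n →₀ ℕ} (h : DegRevLexGT u v)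
    (h' : DegRevLexGT v w) : DegRevLexGT u w := by
  rcases h with h | ⟨h, hr⟩ <;> rcases h' with h' | ⟨h', hr'⟩
  · exact Or.inl (h'.trans h)
  · exact Or.inl (h'.trans_lt h)
  · exact Or.inl (h'.trans_le h.le)
  · exact Or.inr ⟨h'.trans h, hr.trans hr'⟩

theorem DegRevLexGT.irrefl {n : ℕ} (u : Fin n →₀ ℕ) : ¬ DegRevLexGT u u := by
  rintro (h | ⟨-, h⟩)
  exacts [lt_irrefl _ h, RevLexGT.irrefl u h]

theorem degRevLexGT_total {n : ℕ} {u v : Fin n →₀ ℕ} (h : u ≠ v) :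
    DegRevLexGT v u ∨ DegRevLexGT u v := by
  rcases lt_trichotomy u.degree v.degree with hd | hd | hd
  · exact Or.inl (Or.inl hd)
  · rcases revLexGT_trichotomy u v with hr | hr | hr
    exacts [Or.inr (Or.inr ⟨hd.symm, hr⟩), absurd hr h, Or.inl (Or.inr ⟨hd, hr⟩)]
  · exact Or.inr (Or.inl hd)

theorem degRevLexGT_initMon_iff {n : ℕ} {v w : Fin (n + 1) →₀ ℕ} (h : v.degree = w.degree) :
    DegRevLexGT (initMon v) (initMon w) ↔ RevLexGT v w := by
  conv_rhs => rw [← snocMon_initMon v, ← snocMon_initMon w]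
  rw [revLexGT_snocMon_iff, DegRevLexGT]
  rw [degree_eq_degree_initMon_add v, degree_eq_degree_initMon_add w] at h
  refine or_congr ?_ (and_congr_left fun _ => ?_) <;> omega

open Classical in
/-- The number of elements of `N` that are smaller than `u` in the degree reverse lexicographic
order. -/
noncomputable def degRevLexRank {n : ℕ} (N : Finset (Fin n →₀ ℕ)) (u : Fin n →₀ ℕ) : ℕ :=
  (N.filter fun v => DegRevLexGT u v).card

section Rank

variable {n : ℕ} {N : Finset (Fin n →₀ ℕ)}

theorem degRevLexRank_le {u v : Fin n →₀ ℕ} (h : DegRevLexGT v u) :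
    degRevLexRank N u ≤ degRevLexRank N v := by
  classical
  refine Finset.card_le_card fun w hw => ?_
  rw [Finset.mem_filter] at hw ⊢
  exact ⟨hw.1, h.trans hw.2⟩

theorem degRevLexRank_mono {u v : Fin n →₀ ℕ} (h : u ≤ v) :
    degRevLexRank N u ≤ degRevLexRank N v := by
  rcases eq_or_ne u v with rfl | hne
  · rfl
  · refine degRevLexRank_le (Or.inl (lt_of_le_of_ne (Finsupp.degree_mono h) fun he => hne ?_))
    obtain ⟨c, rfl⟩ := exists_add_of_le h
    rw [map_add, left_eq_add, Finsupp.degree_eq_zero_iff] at he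
    rw [he, add_zero]

open Classical in
theorem card_filter_degRevLexRank_lt {r : ℕ} (hr : r ≤ N.card) :
    (N.filter fun u => degRevLexRank N u < r).card = r :=
  card_filter_rank_lt (lt := fun a b : Fin n →₀ ℕ => DegRevLexGT b a)
    (fun _ _ _ h h' => h'.trans h) DegRevLexGT.irrefl (fun _ _ _ _ h => degRevLexGT_total h) hr

open Classical in
/-- The monomials of degree at most `d` form an initial segment. -/
theorem degRevLexRank_lt_card_filter {u : Fin n →₀ ℕ} (hu : u ∈ N) {d : ℕ} (hd : u.degree ≤ d) :
    degRevLexRank N u < (N.filter fun v => v.degree ≤ d).card := by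
  refine Finset.card_lt_card (Finset.ssubset_iff_subset_ne.2 ⟨fun v hv => ?_, fun he => ?_⟩)
  · rw [Finset.mem_filter] at hv ⊢
    refine ⟨hv.1, le_trans ?_ hd⟩
    rcases hv.2 with h | h
    exacts [h.le, h.1.le]
  · have : u ∈ N.filter fun v => DegRevLexGT u v := he ▸ Finset.mem_filter.2 ⟨hu, hd⟩
    exact DegRevLexGT.irrefl u (Finset.mem_filter.1 this).2

end Rank

/-! ### Filling up to a given unimodal Hilbert function -/

/-- The situation of one step of the construction of the ideals `W_m(h)`: `N` is the set of the
monomials outside an Artinian monomial ideal in `n` variables; its numbers of elements of degree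
at most `d` agree with `h` up to the place `k`, in degrees beyond `k` it has no elements, and `h`
decreases weakly from `k` on. -/
structure IsFillData {n : ℕ} (N : Finset (Fin n →₀ ℕ)) (h : ℕ → ℕ) (k : ℕ) : Prop where
  lower : IsLowerSet (N : Set (Fin n →₀ ℕ))
  degree_le : ∀ u ∈ N, u.degree ≤ k
  card : ∀ d ≤ k, (N.filter fun u => u.degree ≤ d).card = h d
  antitone : ∀ i, k ≤ i → h (i + 1) ≤ h i

/-- The monomials in `n + 1` variables that belong to the ideal after the steps in the degrees
below `d`. -/
def filledBelow {n : ℕ} (N : Finset (Fin n →₀ ℕ)) (h : ℕ → ℕ) (k d : ℕ) :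
    Set (Fin (n + 1) →₀ ℕ) :=
  {w | initMon w ∈ N → ∃ e, k ≤ e ∧ e < d ∧ e ≤ w.degree ∧ h e ≤ degRevLexRank N (initMon w)}

namespace IsFillData

variable {n : ℕ} {N : Finset (Fin n →₀ ℕ)} {h : ℕ → ℕ} {k : ℕ}

theorem card_eq (H : IsFillData N h k) : N.card = h k := by
  rw [← H.card k le_rfl, Finset.filter_true_of_mem H.degree_le]

theorem antitoneOn (H : IsFillData N h k) {d e : ℕ} (hk : k ≤ d) (hde : d ≤ e) : h e ≤ h d := by
  induction e, hde using Nat.le_induction with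
  | base => rfl
  | succ e hde ih => exact (H.antitone e (hk.trans hde)).trans ih

theorem rank_lt (H : IsFillData N h k) {u : Fin n →₀ ℕ} (hu : u ∈ N) {d : ℕ} (hd : u.degree ≤ d)
    (hdk : d ≤ k) : degRevLexRank N u < h d := by
  rw [← H.card d hdk]
  exact degRevLexRank_lt_card_filter hu hd

theorem isUpperSet_filledBelow (H : IsFillData N h k) (d : ℕ) :
    IsUpperSet (filledBelow N h k d) := by
  intro w w' hle hw hw'
  have hi : initMon w ≤ initMon w' := fun i => by simpa using hle i.castSucc
  obtain ⟨e, he⟩ := hw (H.lower hi hw')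
  exact ⟨e, he.1, he.2.1, he.2.2.1.trans (Finsupp.degree_mono hle),
    he.2.2.2.trans (degRevLexRank_mono hi)⟩

variable (K : Type*) [Field K]

theorem mem_missingMonomials_filledBelow (H : IsFillData N h k) {d : ℕ} {w : Fin (n + 1) →₀ ℕ} :
    w ∈ missingMonomials (monomialIdeal K (filledBelow N h k d)) d ↔
      w.degree = d ∧ initMon w ∈ N ∧
        ∀ e, k ≤ e → e < d → degRevLexRank N (initMon w) < h e := by
  rw [mem_missingMonomials, monomial_mem_monomialIdeal_of_isUpperSet (H.isUpperSet_filledBelow d)]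
  refine and_congr_right fun hd => ?_
  simp only [filledBelow, Set.mem_ofPred_eq, Classical.not_imp, not_exists, not_and, not_le]
  exact and_congr_right fun _ => forall_congr' fun e => forall₂_congr fun _ he =>
    ⟨fun h' => h' (hd ▸ he.le), fun h' _ => h'⟩

theorem card_filter_revLexGT (H : IsFillData N h k) {d : ℕ} (hk : k ≤ d)
    {w : Fin (n + 1) →₀ ℕ} (hw : w ∈ missingMonomials (monomialIdeal K (filledBelow N h k d)) d) :
    (open Classical in ((missingMonomials (monomialIdeal K (filledBelow N h k d)) d).filter
      fun v => RevLexGT w v).card) = degRevLexRank N (initMon w) := by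
  classical
  rw [H.mem_missingMonomials_filledBelow K] at hw
  rw [degRevLexRank, ← Finset.card_image_of_injOn (f := initMon)]
  · congr 1
    ext u
    simp only [Finset.mem_image, Finset.mem_filter, H.mem_missingMonomials_filledBelow K]
    constructor
    · rintro ⟨v, ⟨⟨hvd, hvN, -⟩, hr⟩, rfl⟩
      exact ⟨hvN, (degRevLexGT_initMon_iff (hw.1.trans hvd.symm)).2 hr⟩
    · rintro ⟨hu, hr⟩
      have hud := (H.degree_le u hu).trans hk
      have hd : (snocMon u (d - u.degree)).degree = d := by rw [degree_snocMon]; omega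
      refine ⟨snocMon u (d - u.degree), ⟨⟨hd, ?_, fun e he hed => ?_⟩, ?_⟩, initMon_snocMon _ _⟩
      · rwa [initMon_snocMon]
      · rw [initMon_snocMon]
        exact (degRevLexRank_le hr).trans_lt (hw.2.2 e he hed)
      · rw [← degRevLexGT_initMon_iff (hw.1.trans hd.symm), initMon_snocMon]
        exact hr
  · intro v hv v' hv' he
    rw [Finset.mem_coe, Finset.mem_filter, mem_missingMonomials] at hv hv'
    exact eq_of_initMon_eq he (hv.1.1.trans hv'.1.1.symm)

/-- In degrees below `k` nothing is added. In a degree `d ≥ k`, the missing monomials correspond,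
in the same order, to the elements `u` of `N` that have survived so far, and those whose rank is
at least `h d` are added. -/
theorem addLargest_filledBelow (H : IsFillData N h k) (d : ℕ) :
    addLargest h (monomialIdeal K (filledBelow N h k d)) d =
      monomialIdeal K (filledBelow N h k (d + 1)) := by
  classical
  have hmem := fun w => mem_largest_sub (lt := RevLexGT) (s := h d) (u := w)
    (S := missingMonomials (monomialIdeal K (filledBelow N h k d)) d)
    (fun _ _ _ h h' => h.trans h') RevLexGT.irrefl (fun a _ b _ hab => by
      rcases revLexGT_trichotomy a b with h | h | h
      exacts [Or.inl h, absurd h hab, Or.inr h])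
  rw [addLargest, hilbertFunction_monomialIdeal, ← monomialIdeal_union]
  set S := missingMonomials (monomialIdeal K (filledBelow N h k d)) d with hS
  rcases lt_or_ge d k with hdk | hdk
  · have h1 : largest RevLexGT (S.card - h d) S = ∅ := by
      have hSc : S.card ≤ h d := by
        rw [← H.card d hdk.le]
        refine Finset.card_le_card_of_injOn initMon (fun w hw => ?_) fun v hv v' hv' he => ?_
        · rw [Finset.mem_coe, hS, H.mem_missingMonomials_filledBelow K] at hw
          refine Finset.mem_coe.2 (Finset.mem_filter.2 ⟨hw.2.1, ?_⟩)
          rw [← hw.1, degree_eq_degree_initMon_add w]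
          exact Nat.le_add_right _ _
        · rw [Finset.mem_coe, hS, mem_missingMonomials] at hv hv'
          exact eq_of_initMon_eq he (hv.1.trans hv'.1.symm)
      refine Finset.eq_empty_of_forall_notMem fun w hw => ?_
      obtain ⟨hw, hle⟩ := (hmem w).1 hw
      have : (S.filter fun v => RevLexGT w v).card < S.card :=
        Finset.card_lt_card (Finset.filter_ssubset.2 ⟨w, hw, RevLexGT.irrefl w⟩)
      omega
    rw [h1, Finset.coe_empty, Set.union_empty]
    congr 1
    ext w
    refine imp_congr_right fun _ => exists_congr fun e => ?_
    refine and_congr_right fun he => and_congr_left fun _ => ?_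
    omega
  · have h1 : ∀ w, w ∈ largest RevLexGT (S.card - h d) S ↔
        w ∈ S ∧ h d ≤ degRevLexRank N (initMon w) := fun w => by
      rw [hmem]
      exact and_congr_right fun hw => by rw [H.card_filter_revLexGT K hdk hw]
    refine le_antisymm (monomialIdeal_mono (Set.union_subset ?_ ?_)) (Ideal.span_le.2 ?_)
    · intro w hw hwN
      obtain ⟨e, he⟩ := hw hwN
      exact ⟨e, he.1, by omega, he.2.2⟩
    · intro w hw hwN
      obtain ⟨hw, hle⟩ := (h1 w).1 hw
      rw [hS, mem_missingMonomials] at hw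
      exact ⟨d, hdk, by omega, hw.1.ge, hle⟩
    · rintro _ ⟨w, hw, rfl⟩
      refine monomial_mem_monomialIdeal.2 ?_
      by_cases hw' : w ∈ filledBelow N h k d
      · exact ⟨w, Or.inl hw', le_rfl⟩
      · simp only [filledBelow, Set.mem_ofPred_eq, Classical.not_imp, not_exists, not_and,
          not_le] at hw'
        obtain ⟨hwN, hlt⟩ := hw'
        obtain ⟨e, hke, hed, hew, hle⟩ := hw hwN
        have hed' : e = d := by
          by_contra hne
          exact (hlt e hke (by omega) hew).not_ge hle
        subst hed'
        -- lowering the exponent of `x_{n+1}` in `w` down to degree `e` gives an added monomial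
        have hwk := (H.degree_le _ hwN).trans hdk
        have hwd := degree_eq_degree_initMon_add w
        refine ⟨snocMon (initMon w) (e - (initMon w).degree), Or.inr ?_, fun i => ?_⟩
        · refine (h1 _).2 ⟨(H.mem_missingMonomials_filledBelow K).2 ⟨?_, ?_, ?_⟩, ?_⟩
          · rw [degree_snocMon]; omega
          · rwa [initMon_snocMon]
          · rw [initMon_snocMon]
            exact fun e' h1 h2 => hlt e' h1 h2 (by omega)
          · rwa [initMon_snocMon]
        · induction i using Fin.lastCases with
          | last => rw [snocMon_last]; omega
          | cast i => simp

variable {K} {J : Ideal (MvPolynomial (Fin n) K)}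

theorem extendIdeal_eq {S : Set (Fin n →₀ ℕ)} (hN : ∀ u, u ∈ N ↔ monomial u 1 ∉ J)
    (hJ : J = monomialIdeal K S) :
    extendIdeal J = monomialIdeal K (filledBelow N h k 0) := by
  have h1 : extendIdeal J = monomialIdeal K ((fun s => snocMon s 0) '' S) := by
    rw [extendIdeal, hJ, monomialIdeal, Ideal.map_span, Set.image_image, monomialIdeal,
      Set.image_image]
    congr 1
    refine Set.image_congr fun s _ => ?_
    refine (rename_monomial _ _ _).trans (congrArg (fun u => monomial u (1 : K)) ?_)
    ext i
    induction i using Fin.lastCases with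
    | last =>
      rw [snocMon_last, Finsupp.mapDomain_of_notMem_range]
      rintro ⟨j, hj⟩
      exact Fin.castSucc_ne_last j hj
    | cast i =>
      rw [Finsupp.mapDomain_apply (Fin.castSucc_injective n), snocMon_castSucc]
  rw [h1]
  refine le_antisymm (monomialIdeal_mono ?_) (Ideal.span_le.2 ?_)
  · rintro _ ⟨s, hs, rfl⟩ hsN
    rw [initMon_snocMon, hN, hJ] at hsN
    exact absurd (monomial_mem_monomialIdeal.2 ⟨s, hs, le_rfl⟩) hsN
  · rintro _ ⟨w, hw, rfl⟩
    have hw' : initMon w ∉ N := fun hwN => by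
      obtain ⟨e, -, he, -⟩ := hw hwN
      exact Nat.not_lt_zero e he
    rw [hN, not_not, hJ, monomial_mem_monomialIdeal] at hw'
    obtain ⟨s, hs, hle⟩ := hw'
    refine monomial_mem_monomialIdeal.2 ⟨_, ⟨s, hs, rfl⟩, fun i => ?_⟩
    induction i using Fin.lastCases with
    | last => simp
    | cast i => simpa using hle i

theorem fillIdeal_eq (H : IsFillData N h k) {S : Set (Fin n →₀ ℕ)}
    (hN : ∀ u, u ∈ N ↔ monomial u 1 ∉ J) (hJ : J = monomialIdeal K S) :
    fillIdeal h (extendIdeal J) = monomialIdeal K (⋃ d, filledBelow N h k d) := by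
  rw [fillIdeal, monomialIdeal_iUnion]
  refine iSup_congr fun d => ?_
  induction d with
  | zero => exact extendIdeal_eq hN hJ
  | succ d ih => rw [fillBelow, ih, H.addLargest_filledBelow K]

/-- The monomials outside the filled ideal: in degree `d` they are the multiples by powers of the
last variable of the `h d` smallest elements of `N`. -/
theorem monomial_notMem_fillIdeal_iff (H : IsFillData N h k) {S : Set (Fin n →₀ ℕ)}
    (hN : ∀ u, u ∈ N ↔ monomial u 1 ∉ J) (hJ : J = monomialIdeal K S) {w : Fin (n + 1) →₀ ℕ} :
    monomial w (1 : K) ∉ fillIdeal h (extendIdeal J) ↔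
      initMon w ∈ N ∧ degRevLexRank N (initMon w) < h w.degree := by
  rw [H.fillIdeal_eq hN hJ,
    monomial_mem_monomialIdeal_of_isUpperSet (isUpperSet_iUnion H.isUpperSet_filledBelow),
    Set.mem_iUnion, not_exists]
  simp only [filledBelow, Set.mem_ofPred_eq, Classical.not_imp, not_exists, not_and, not_le]
  constructor
  · intro hw
    refine ⟨(hw 0).1, ?_⟩
    rcases lt_or_ge w.degree k with hk | hk
    · exact H.rank_lt (hw 0).1 (degree_eq_degree_initMon_add w ▸ Nat.le_add_right _ _) hk.le
    · exact (hw (w.degree + 1)).2 _ hk (by omega) le_rfl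
  · exact fun hw d => ⟨hw.1, fun e hke _ hew => hw.2.trans_le (H.antitoneOn hke hew)⟩

end IsFillData

section

variable {K : Type*} [Field K] {n : ℕ} {N : Finset (Fin n →₀ ℕ)} {h : ℕ → ℕ} {k : ℕ}
  {J : Ideal (MvPolynomial (Fin n) K)}

theorem sum_deltaSeq (hk : ∀ i, i < k → h i < h (i + 1)) {d : ℕ} (hd : d ≤ k) :
    ∑ i ∈ Finset.range (d + 1), deltaSeq h i = h d := by
  induction d with
  | zero => simp [deltaSeq]
  | succ d ih =>
    rw [Finset.sum_range_succ, ih (by omega), deltaSeq]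
    have := hk d (by omega)
    omega

theorem exists_isFillData {S : Set (Fin n →₀ ℕ)} (hJ : J = monomialIdeal K S)
    (hJh : ∀ d, hilbertFunction J d = deltaSeq h d) (hh : IsUnimodalSeq h) :
    ∃ (N : Finset (Fin n →₀ ℕ)) (k : ℕ), (∀ u, u ∈ N ↔ monomial u 1 ∉ J) ∧ IsFillData N h k := by
  classical
  obtain ⟨k, hlt, hge⟩ := hh
  have hcard : ∀ d, (missingMonomials J d).card = deltaSeq h d := fun d => by
    rw [← hJh d, hJ, hilbertFunction_monomialIdeal]
  have hN : ∀ u, u ∈ (Finset.range (k + 1)).biUnion (missingMonomials J) ↔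
      monomial u (1 : K) ∉ J := fun u => by
    simp only [Finset.mem_biUnion, Finset.mem_range, mem_missingMonomials]
    refine ⟨fun ⟨_, _, _, hu⟩ => hu, fun hu => ⟨u.degree, ?_, rfl, hu⟩⟩
    by_contra hc
    obtain ⟨d, hd⟩ : ∃ d, u.degree = d + 1 := ⟨u.degree - 1, by omega⟩
    have h0 : (missingMonomials J u.degree).card = 0 := by
      rw [hcard, hd, deltaSeq]
      have := hge d (by omega)
      omega
    rw [Finset.card_eq_zero] at h0
    exact Finset.notMem_empty u (h0 ▸ mem_missingMonomials.2 ⟨rfl, hu⟩)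
  refine ⟨_, k, hN, ⟨fun u v hvu hu => ?_, fun u hu => ?_, fun d hd => ?_, hge⟩⟩
  · rw [Finset.mem_coe, hN, hJ, monomial_mem_monomialIdeal] at hu ⊢
    exact fun ⟨s, hs, hle⟩ => hu ⟨s, hs, hle.trans hvu⟩
  · simp only [Finset.mem_biUnion, Finset.mem_range, mem_missingMonomials] at hu
    obtain ⟨d, hd, hud, -⟩ := hu
    omega
  · have h1 : ((Finset.range (k + 1)).biUnion (missingMonomials J)).filter
        (fun u => u.degree ≤ d) = (Finset.range (d + 1)).biUnion (missingMonomials J) := by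
      ext u
      simp only [Finset.mem_filter, Finset.mem_biUnion, Finset.mem_range, mem_missingMonomials]
      constructor
      · rintro ⟨⟨e, he, rfl, hu⟩, hd⟩
        exact ⟨_, by omega, rfl, hu⟩
      · rintro ⟨e, he, rfl, hu⟩
        exact ⟨⟨_, by omega, rfl, hu⟩, by omega⟩
    rw [h1, Finset.card_biUnion, ← sum_deltaSeq hlt hd]
    · exact Finset.sum_congr rfl fun i _ => hcard i
    · intro i _ j _ hij
      rw [Function.onFun, Finset.disjoint_left]
      intro u hu hu'
      rw [mem_missingMonomials] at hu hu'
      exact hij (hu.1.symm.trans hu'.1)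

namespace IsFillData

theorem hilbertFunction_fillIdeal (H : IsFillData N h k) {S : Set (Fin n →₀ ℕ)}
    (hN : ∀ u, u ∈ N ↔ monomial u 1 ∉ J) (hJ : J = monomialIdeal K S) (d : ℕ) :
    hilbertFunction (fillIdeal h (extendIdeal J)) d = h d := by
  classical
  have h1 : (missingMonomials (fillIdeal h (extendIdeal J)) d).card =
      (N.filter fun u => u.degree ≤ d ∧ degRevLexRank N u < h d).card := by
    rw [← Finset.card_image_of_injOn (f := initMon)]
    · congr 1
      ext u
      simp only [Finset.mem_image, Finset.mem_filter, mem_missingMonomials,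
        H.monomial_notMem_fillIdeal_iff hN hJ]
      constructor
      · rintro ⟨w, ⟨rfl, hw, hlt⟩, rfl⟩
        exact ⟨hw, degree_eq_degree_initMon_add w ▸ Nat.le_add_right _ _, hlt⟩
      · rintro ⟨hu, hd, hlt⟩
        have hwd : (snocMon u (d - u.degree)).degree = d := by rw [degree_snocMon]; omega
        refine ⟨snocMon u (d - u.degree), ⟨hwd, ?_, ?_⟩, initMon_snocMon _ _⟩
        · rwa [initMon_snocMon]
        · rwa [initMon_snocMon, hwd]
    · intro v hv v' hv' he
      rw [Finset.mem_coe, mem_missingMonomials] at hv hv'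
      exact eq_of_initMon_eq he (hv.1.trans hv'.1.symm)
  have h2 := h1
  rw [H.fillIdeal_eq hN hJ] at h2 ⊢
  rw [hilbertFunction_monomialIdeal, h2]
  rcases le_total d k with hd | hd
  · rw [← H.card d hd]
    congr 1
    refine Finset.filter_congr fun u hu => and_iff_left_of_imp fun hud => ?_
    rw [H.card d hd]
    exact H.rank_lt hu hud hd
  · have hle : h d ≤ N.card := H.card_eq ▸ H.antitoneOn le_rfl hd
    rw [← card_filter_degRevLexRank_lt hle]
    congr 1
    refine Finset.filter_congr fun u hu => ?_
    rw [card_filter_degRevLexRank_lt hle]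
    exact and_iff_right ((H.degree_le u hu).trans hd)

theorem isStronglyStable_fillIdeal (H : IsFillData N h k)
    (hN : ∀ u, u ∈ N ↔ monomial u 1 ∉ J) (hJ : IsStronglyStable J) :
    IsStronglyStable (fillIdeal h (extendIdeal J)) := by
  obtain ⟨⟨S, hS⟩, hst⟩ := hJ
  refine ⟨⟨_, H.fillIdeal_eq hN hS⟩, fun u hu i j hij hj => ?_⟩
  by_contra hv
  rw [H.monomial_notMem_fillIdeal_iff hN hS, degree_sub_single_add_single hj] at hv
  refine absurd hu ((H.monomial_notMem_fillIdeal_iff hN hS).2 ?_)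
  obtain ⟨i, rfl⟩ := Fin.exists_castSucc_eq.2 (hij.trans_le (Fin.le_last j)).ne
  induction j using Fin.lastCases with
  | last =>
    have hle : initMon u ≤ initMon (u - Finsupp.single (Fin.last n) 1 +
        Finsupp.single i.castSucc 1) := fun l => by simp
    exact ⟨H.lower hle hv.1, (degRevLexRank_mono hle).trans_lt hv.2⟩
  | cast j =>
    have hij' : i < j := by simpa using hij
    have hj' : 0 < initMon u j := by simpa using hj
    have he : initMon (u - Finsupp.single j.castSucc 1 + Finsupp.single i.castSucc 1) =
        initMon u - Finsupp.single j 1 + Finsupp.single i 1 := by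
      ext l
      simp [Finsupp.single_apply]
    rw [he] at hv
    refine ⟨?_, (degRevLexRank_le (Or.inr ⟨?_, j, ?_, fun l hl => ?_⟩)).trans_lt hv.2⟩
    · rw [hN]
      exact fun hc => (hN _).1 hv.1 (hst _ hc i j hij' hj')
    · rw [degree_sub_single_add_single hj']
    · simp only [Finsupp.coe_add, Finsupp.coe_tsub, Pi.add_apply, Pi.sub_apply,
        Finsupp.single_eq_same, Finsupp.single_apply, if_neg hij'.ne]
      omega
    · simp [hl.ne', (hij'.trans hl).ne']

/-- The last variable is a weak Lefschetz element: in degrees below `k` multiplication by it maps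
the standard monomials injectively to standard monomials, and in degrees beyond `k` all standard
monomials are divisible by it. -/
theorem isWeakLefschetzElement_X_last (H : IsFillData N h k) {S : Set (Fin n →₀ ℕ)}
    (hN : ∀ u, u ∈ N ↔ monomial u 1 ∉ J) (hJ : J = monomialIdeal K S) :
    IsWeakLefschetzElement (fillIdeal h (extendIdeal J)) (X (Fin.last n)) := by
  have hmem : ∀ f : MvPolynomial (Fin (n + 1)) K, f ∈ fillIdeal h (extendIdeal J) ↔
      ∀ u ∈ f.support, monomial u (1 : K) ∈ fillIdeal h (extendIdeal J) := by
    rw [H.fillIdeal_eq hN hJ]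
    exact fun f => mem_monomialIdeal_iff_monomial_mem
  refine isWeakLefschetzElement_iff.2 ⟨isHomogeneous_X _ _, fun d _ => ?_⟩
  rcases lt_or_ge d k with hd | hd
  · refine Or.inl fun f hf hXf => (hmem f).2 fun w hw => ?_
    by_contra hc
    have hwd : w.degree = d := by
      by_contra hne
      exact mem_support_iff.1 hw (hf.coeff_eq_zero hne)
    refine absurd ((hmem _).1 hXf (w + Finsupp.single (Fin.last n) 1) ?_) ?_
    · rw [mem_support_iff, add_comm w, coeff_X_mul]
      exact mem_support_iff.1 hw
    · rw [H.monomial_notMem_fillIdeal_iff hN hJ] at hc ⊢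
      rw [initMon_add_single_last]
      refine ⟨hc.1, ?_⟩
      rw [map_add, Finsupp.degree_single, hwd]
      refine H.rank_lt hc.1 ?_ hd
      have := degree_eq_degree_initMon_add w
      omega
  · refine Or.inr fun g hg => ⟨divMonomial g (Finsupp.single (Fin.last n) 1), fun u hu => ?_, ?_⟩
    · rw [coeff_divMonomial] at hu
      have := hg hu
      rw [map_add] at this
      simp only [Finsupp.weight_single, Pi.one_apply, smul_eq_mul, mul_one] at this
      omega
    · have h1 := divMonomial_add_modMonomial_single g (Fin.last n)
      rw [← eq_sub_iff_add_eq] at h1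
      rw [h1, sub_sub_cancel_left, neg_mem_iff, hmem]
      intro w hw
      have hle : ¬ Finsupp.single (Fin.last n) 1 ≤ w := fun hle =>
        mem_support_iff.1 hw (coeff_modMonomial_of_le g hle)
      rw [mem_support_iff, coeff_modMonomial_of_not_le _ hle] at hw
      by_contra hc
      rw [H.monomial_notMem_fillIdeal_iff hN hJ] at hc
      have h2 := H.degree_le _ hc.1
      have h3 := degree_eq_degree_initMon_add w
      have h4 : w.degree = d + 1 := by
        by_contra hne
        exact hw (hg.coeff_eq_zero hne)
      refine hle ?_
      rw [Finsupp.single_le_iff]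
      omega

end IsFillData

/-! ### Passing to the quotient by the last variable -/

/-- The homomorphism that sets the last variable equal to zero. -/
noncomputable def killLast (K : Type*) [Field K] (n : ℕ) :
    MvPolynomial (Fin (n + 1)) K →ₐ[K] MvPolynomial (Fin n) K :=
  aeval (Fin.snoc (α := fun _ => MvPolynomial (Fin n) K) X 0)

theorem killLast_X_last : killLast K n (X (Fin.last n)) = 0 := by
  simp [killLast]

theorem killLast_X_castSucc (i : Fin n) : killLast K n (X i.castSucc) = X i := by
  simp [killLast]

theorem killLast_rename (f : MvPolynomial (Fin n) K) :
    killLast K n (rename Fin.castSucc f) = f := by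
  have : (killLast K n).comp (rename Fin.castSucc) = AlgHom.id K _ := by
    ext i
    simp [killLast_X_castSucc]
  exact DFunLike.congr_fun this f

theorem isHomogeneous_killLast {f : MvPolynomial (Fin (n + 1)) K} {d : ℕ} (hf : f.IsHomogeneous d) :
    (killLast K n f).IsHomogeneous d := by
  have h1 := hf.aeval (n := 1) (Fin.snoc (α := fun _ => MvPolynomial (Fin n) K) X 0) fun i => by
    induction i using Fin.lastCases with
    | last => simpa using isHomogeneous_zero _ _ _
    | cast i => simpa using isHomogeneous_X _ _
  rwa [one_mul] at h1

theorem sub_rename_killLast_mem (f : MvPolynomial (Fin (n + 1)) K) :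
    f - rename Fin.castSucc (killLast K n f) ∈
      Ideal.span {(X (Fin.last n) : MvPolynomial (Fin (n + 1)) K)} := by
  rw [← Ideal.Quotient.eq]
  have : (Ideal.Quotient.mkₐ K (Ideal.span {(X (Fin.last n) : MvPolynomial (Fin (n + 1)) K)})) =
      ((Ideal.Quotient.mkₐ K _).comp (rename Fin.castSucc)).comp (killLast K n) := by
    ext i
    induction i using Fin.lastCases with
    | last =>
      simp only [AlgHom.comp_apply, killLast_X_last, map_zero]
      exact Ideal.Quotient.eq_zero_iff_mem.2 (Ideal.mem_span_singleton_self _)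
    | cast i => simp [killLast_X_castSucc]
  exact DFunLike.congr_fun this f

theorem killLast_monomial_mem {w : Fin (n + 1) →₀ ℕ}
    (hw : w (Fin.last n) = 0 → monomial (initMon w) (1 : K) ∈ J) :
    killLast K n (monomial w 1) ∈ J := by
  by_cases h0 : w (Fin.last n) = 0
  · have : monomial w (1 : K) = rename Fin.castSucc (monomial (initMon w) 1) := by
      refine (congrArg (fun u => monomial u (1 : K)) ?_).trans (rename_monomial _ _ _).symm
      ext i
      induction i using Fin.lastCases with
      | last =>
        rw [h0, Finsupp.mapDomain_of_notMem_range]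
        rintro ⟨j, hj⟩
        exact Fin.castSucc_ne_last j hj
      | cast i => rw [Finsupp.mapDomain_apply (Fin.castSucc_injective n), initMon_apply]
    rw [this, killLast_rename]
    exact hw h0
  · obtain ⟨g, hg⟩ : (X (Fin.last n) : MvPolynomial (Fin (n + 1)) K) ∣ monomial w 1 :=
      X_dvd_monomial.2 (Or.inr h0)
    rw [hg, map_mul, killLast_X_last, zero_mul]
    exact zero_mem _

theorem IsFillData.fillIdeal_le_comap (H : IsFillData N h k) {S : Set (Fin n →₀ ℕ)}
    (hN : ∀ u, u ∈ N ↔ monomial u 1 ∉ J) (hJ : J = monomialIdeal K S) :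
    fillIdeal h (extendIdeal J) ≤ J.comap (killLast K n) := by
  have h1 := H.fillIdeal_eq hN hJ
  rw [h1]
  refine Ideal.span_le.2 ?_
  rintro _ ⟨w, hw, rfl⟩
  refine killLast_monomial_mem fun h0 => ?_
  have h2 : monomial w (1 : K) ∈ fillIdeal h (extendIdeal J) :=
    h1 ▸ monomial_mem_monomialIdeal.2 ⟨w, hw, le_rfl⟩
  by_contra hc
  refine absurd h2 ((H.monomial_notMem_fillIdeal_iff hN hJ).2 ⟨(hN _).2 hc, ?_⟩)
  have h3 := degree_eq_degree_initMon_add w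
  rw [h0, add_zero] at h3
  exact H.rank_lt ((hN _).2 hc) h3.ge (h3 ▸ H.degree_le _ ((hN _).2 hc))

/-- If `x_{n+1}` is a weak Lefschetz element of `R / W` and the quotient by it is a polynomial
ring modulo `J`, then Lefschetz elements for `J` prolong the sequence. -/
theorem hasWLPTimes_succ {W : Ideal (MvPolynomial (Fin (n + 1)) K)} {m : ℕ}
    (hX : IsWeakLefschetzElement W (X (Fin.last n))) (hJW : extendIdeal J ≤ W)
    (hWJ : W ≤ J.comap (killLast K n)) (hJ : HasWLPTimes m J) : HasWLPTimes (m + 1) W := by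
  obtain ⟨l, hl⟩ := hJ
  set L : Fin (m + 1) → MvPolynomial (Fin (n + 1)) K :=
    Fin.cons (X (Fin.last n)) fun i => rename Fin.castSucc (l i) with hL
  have hL0 : L 0 = X (Fin.last n) := rfl
  have hLs : ∀ i : Fin m, L i.succ = rename Fin.castSucc (l i) := fun i => rfl
  refine ⟨L, fun i => ?_⟩
  induction i using Fin.cases with
  | zero =>
    have : {f | ∃ j < 0, f = L j} = ∅ := by
      ext f
      simp
    rw [this, Ideal.span_empty, sup_bot_eq]
    exact hX
  | succ i =>
    set J' := J ⊔ Ideal.span {f | ∃ j < i, f = l j} with hJ'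
    have hI : W ⊔ Ideal.span {f | ∃ j < i.succ, f = L j} = J'.comap (killLast K n) := by
      refine le_antisymm (sup_le (hWJ.trans (Ideal.comap_mono le_sup_left)) ?_) fun f hf => ?_
      · refine Ideal.span_le.2 ?_
        rintro _ ⟨j, hj, rfl⟩
        induction j using Fin.cases with
        | zero =>
          rw [SetLike.mem_coe, Ideal.mem_comap, hL0, killLast_X_last]
          exact zero_mem _
        | succ j =>
          rw [SetLike.mem_coe, Ideal.mem_comap, hLs, killLast_rename]
          exact Ideal.mem_sup_right (Ideal.subset_span ⟨j, by simpa using hj, rfl⟩)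
      · have h1 : rename Fin.castSucc (killLast K n f) ∈
            W ⊔ Ideal.span {f | ∃ j < i.succ, f = L j} := by
          have h2 := Ideal.mem_map_of_mem
            (rename Fin.castSucc : MvPolynomial (Fin n) K →ₐ[K] MvPolynomial (Fin (n + 1)) K)
            (Ideal.mem_comap.1 hf)
          rw [hJ', Ideal.map_sup, Ideal.map_span] at h2
          refine sup_le_sup hJW (Ideal.span_mono ?_) h2
          rintro _ ⟨_, ⟨j, hj, rfl⟩, rfl⟩
          exact ⟨j.succ, by simpa using hj, rfl⟩
        have h3 : f - rename Fin.castSucc (killLast K n f) ∈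
            W ⊔ Ideal.span {f | ∃ j < i.succ, f = L j} := by
          refine (Ideal.span_le.2 ?_ : _ ≤ _) (sub_rename_killLast_mem f)
          rw [Set.singleton_subset_iff]
          exact Ideal.mem_sup_right (Ideal.subset_span ⟨0, Fin.succ_pos i, hL0.symm⟩)
        simpa using add_mem h3 h1
    rw [hI, hLs]
    obtain ⟨hl1, hld⟩ := isWeakLefschetzElement_iff.1 (hl i)
    refine isWeakLefschetzElement_iff.2 ⟨hl1.rename_isHomogeneous, fun d hd => ?_⟩
    refine (hld d hd).imp (fun hinj f hf hlf => ?_) fun hsurj g hg => ?_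
    · rw [Ideal.mem_comap, map_mul, killLast_rename] at hlf
      exact hinj _ (isHomogeneous_killLast hf) hlf
    · obtain ⟨f, hf, hfg⟩ := hsurj _ (isHomogeneous_killLast hg)
      refine ⟨rename Fin.castSucc f, hf.rename_isHomogeneous, ?_⟩
      rw [Ideal.mem_comap, map_sub, map_mul, killLast_rename, killLast_rename]
      exact hfg

end

/-! ### The ideals `W_m(h)` -/

theorem IsOSequence.apply_zero {K : Type*} [Field K] {h : ℕ → ℕ} (hh : IsOSequence K h) :
    h 0 = 1 := by
  obtain ⟨n, I, -, hI, hd⟩ := hh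
  rw [← hd 0, hilbertFunction_zero hI]

theorem IsWeakLefschetzOSequence.isFiniteOSequence {K : Type*} [Field K] {m : ℕ} {h : ℕ → ℕ}
    (hh : IsWeakLefschetzOSequence K m h) : IsFiniteOSequence K h := by
  cases m with
  | zero => exact hh
  | succ m => exact hh.1

/-- In the polynomial ring without variables every linear form is zero, and every ideal has the
weak Lefschetz property. -/
theorem hasWLPTimes_of_isEmpty {K : Type*} [Field K] (m : ℕ) (I : Ideal (MvPolynomial (Fin 0) K)) :
    HasWLPTimes m I := by
  refine ⟨fun _ => 0, fun i => isWeakLefschetzElement_iff.2 ⟨isHomogeneous_zero _ _ _, ?_⟩⟩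
  refine fun d hd => Or.inl fun f hf _ => ?_
  have : f = 0 := by
    by_contra h0
    have := hf.inj_right (isHomogeneous_of_isEmpty _ _ f) h0
    omega
  rw [this]
  exact zero_mem _

theorem hilbertFunction_bot_of_isEmpty {K : Type*} [Field K] (d : ℕ) :
    hilbertFunction (⊥ : Ideal (MvPolynomial (Fin 0) K)) d = if d = 0 then 1 else 0 := by
  split_ifs with h0
  · rw [h0, hilbertFunction_zero bot_ne_top]
  · rw [hilbertFunction_eq_zero_iff]
    intro f hf
    by_contra hne
    exact h0 (hf.inj_right (isHomogeneous_of_isEmpty _ _ f) hne)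

theorem lefschetzIdealAux_spec {K : Type*} [Field K] (m n : ℕ) (h : ℕ → ℕ)
    (hh : IsWeakLefschetzOSequence K m h) (hn : h 1 = n) :
    IsStronglyStable (lefschetzIdealAux K m n h) ∧
      (∀ d, hilbertFunction (lefschetzIdealAux K m n h) d = h d) ∧
      HasWLPTimes m (lefschetzIdealAux K m n h) := by
  induction m generalizing n h with
  | zero =>
    subst hn
    exact ⟨hh.1.isStronglyStable_lexIdeal, hh.1.hilbertFunction_lexIdeal, ⟨fun _ => 0, fun i => i.elim0⟩⟩
  | succ m ih =>
    cases n with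
    | zero =>
      refine ⟨⟨⟨∅, by simp [lefschetzIdealAux, monomialIdeal]⟩, fun u _ i => i.elim0⟩,
        fun d => ?_, hasWLPTimes_of_isEmpty _ _⟩
      rw [lefschetzIdealAux, hilbertFunction_bot_of_isEmpty]
      obtain ⟨_, I, -, -, hI⟩ := hh.1.1
      split_ifs with hd
      · rw [hd, hh.1.1.apply_zero]
      · have h1 : hilbertFunction I 1 = 0 := (hI 1).trans hn
        rw [← hI d, hilbertFunction_eq_zero_of_le h1 (by omega)]
    | succ n =>
      obtain ⟨hfin, huni, hdelta⟩ := hh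
      have h0 := hfin.1.apply_zero
      obtain ⟨hst, hhilb, hwlp⟩ := ih n (deltaSeq h) hdelta (by
        rw [deltaSeq, hn, h0, Nat.add_sub_cancel])
      obtain ⟨S, hS⟩ := hst.1
      obtain ⟨N, k, hN, H⟩ := exists_isFillData hS hhilb huni
      refine ⟨H.isStronglyStable_fillIdeal hN hst, H.hilbertFunction_fillIdeal hN hS, ?_⟩
      refine hasWLPTimes_succ (H.isWeakLefschetzElement_X_last hN hS) ?_
        (H.fillIdeal_le_comap hN hS) hwlp
      exact le_iSup (fillBelow h (extendIdeal (lefschetzIdealAux K m n (deltaSeq h)))) 0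

/-! ### Hilbert functions modulo a linear form -/

section

variable {K : Type*} [Field K] {n : ℕ} {I : Ideal (MvPolynomial (Fin n) K)}
  {l : MvPolynomial (Fin n) K}

theorem homogeneousComponent_mul_of_isHomogeneous {σ : Type*} {f : MvPolynomial σ K} {i : ℕ}
    (hf : f.IsHomogeneous i) (g : MvPolynomial σ K) (j : ℕ) :
    homogeneousComponent (i + j) (f * g) = f * homogeneousComponent j g := by
  have := DirectSum.coe_decompose_mul_add_of_left_mem (𝒜 := homogeneousSubmodule σ K)
    (a := f) (b := g) (i := i) (j := j) hf
  rwa [← decomposition.decompose'_apply, ← decomposition.decompose'_apply]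

theorem isHomogIdeal_sup_span_singleton (hI : IsHomogIdeal I) (hl : l.IsHomogeneous 1) :
    IsHomogIdeal (I ⊔ Ideal.span {l}) := by
  refine Ideal.IsHomogeneous.sup hI (Ideal.homogeneous_span _ _ ?_)
  rintro _ rfl
  exact ⟨1, hl⟩

theorem sup_span_singleton_ne_top (hI : IsHomogIdeal I) (hI' : I ≠ ⊤) (hl : l.IsHomogeneous 1) :
    I ⊔ Ideal.span {l} ≠ ⊤ := by
  intro h
  have hle : I ⊔ Ideal.span {l} ≤ RingHom.ker (constantCoeff (R := K) (σ := Fin n)) := by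
    refine sup_le (fun f hf => ?_) (Ideal.span_le.2 ?_)
    · have h1 := homogeneousComponent_mem_of_mem hI hf 0
      rw [homogeneousComponent_zero] at h1
      rw [RingHom.mem_ker, constantCoeff_eq]
      by_contra hc
      exact hI' (Ideal.eq_top_of_isUnit_mem _ h1 ((isUnit_iff_ne_zero.2 hc).map C))
    · rw [Set.singleton_subset_iff, SetLike.mem_coe, RingHom.mem_ker, constantCoeff_eq]
      exact hl.coeff_eq_zero (by simp)
  rw [h, top_le_iff] at hle
  exact RingHom.ker_ne_top _ hle

/-- If a form of degree `d + 1` belongs to `I + (l)`, then it is congruent modulo `I` to the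
product of `l` with a form of degree `d`. -/
theorem exists_isHomogeneous_mul_sub_mem (hI : IsHomogIdeal I) (hl : l.IsHomogeneous 1) {d : ℕ}
    {f : MvPolynomial (Fin n) K} (hf : f.IsHomogeneous (d + 1)) (hfI : f ∈ I ⊔ Ideal.span {l}) :
    ∃ g : MvPolynomial (Fin n) K, g.IsHomogeneous d ∧ l * g - f ∈ I := by
  obtain ⟨a, ha, b, hb, rfl⟩ := Submodule.mem_sup.1 hfI
  obtain ⟨c, rfl⟩ := Ideal.mem_span_singleton.1 hb
  refine ⟨homogeneousComponent d c, homogeneousComponent_isHomogeneous _ _, ?_⟩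
  rw [← homogeneousComponent_mul_of_isHomogeneous hl, ← homogeneousComponent_eq_self hf, map_add,
    add_comm 1 d, sub_add_cancel_right, neg_mem_iff]
  exact homogeneousComponent_mem_of_mem hI ha _

/-- The rank `r` of the multiplication by `l` from degree `d` to degree `d + 1`. -/
theorem exists_rank_mul (hI : IsHomogIdeal I) (hl : l.IsHomogeneous 1) (d : ℕ) :
    ∃ r, hilbertFunction (I ⊔ Ideal.span {l}) (d + 1) + r = hilbertFunction I (d + 1) ∧
      r ≤ hilbertFunction I d ∧
      ((∀ f : MvPolynomial (Fin n) K, f.IsHomogeneous d → l * f ∈ I → f ∈ I) →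
        r = hilbertFunction I d) := by
  have hmaps : ∀ a ∈ gradedPiece I d,
      LinearMap.mulLeft K (Ideal.Quotient.mk I l) a ∈ gradedPiece I (d + 1) := by
    intro a ha
    obtain ⟨f, hf, rfl⟩ := mem_gradedPiece.1 ha
    exact mem_gradedPiece.2 ⟨l * f, add_comm 1 d ▸ hl.mul hf, map_mul _ _ _⟩
  let φ : gradedPiece I d →ₗ[K] gradedPiece I (d + 1) :=
    (LinearMap.mulLeft K (Ideal.Quotient.mk I l)).restrict hmaps
  let π : (MvPolynomial (Fin n) K ⧸ I) →ₐ[K] MvPolynomial (Fin n) K ⧸ (I ⊔ Ideal.span {l}) :=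
    Ideal.Quotient.factorₐ K le_sup_left
  have hπ : ∀ f, π (Ideal.Quotient.mk I f) = Ideal.Quotient.mk _ f := fun f => rfl
  let ψ := π.toLinearMap.domRestrict (gradedPiece I (d + 1))
  have hrange : LinearMap.range ψ = gradedPiece (I ⊔ Ideal.span {l}) (d + 1) := by
    ext b
    rw [LinearMap.mem_range, mem_gradedPiece]
    constructor
    · rintro ⟨⟨a, ha⟩, rfl⟩
      obtain ⟨f, hf, rfl⟩ := mem_gradedPiece.1 ha
      exact ⟨f, hf, rfl⟩
    · rintro ⟨f, hf, rfl⟩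
      exact ⟨⟨_, mem_gradedPiece.2 ⟨f, hf, rfl⟩⟩, rfl⟩
  have hker : LinearMap.ker ψ = LinearMap.range φ := by
    ext ⟨a, ha⟩
    obtain ⟨f, hf, rfl⟩ := mem_gradedPiece.1 ha
    rw [LinearMap.mem_ker, LinearMap.mem_range]
    constructor
    · intro h
      obtain ⟨g, hg, hgf⟩ := exists_isHomogeneous_mul_sub_mem hI hl hf
        (Ideal.Quotient.eq_zero_iff_mem.1 h)
      refine ⟨⟨_, mem_gradedPiece.2 ⟨g, hg, rfl⟩⟩, Subtype.ext ?_⟩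
      exact (map_mul (Ideal.Quotient.mk I) l g).symm.trans (Ideal.Quotient.eq.2 hgf)
    · rintro ⟨⟨b, hb⟩, h⟩
      obtain ⟨g, hg, rfl⟩ := mem_gradedPiece.1 hb
      have h1 : Ideal.Quotient.mk I (l * g) = Ideal.Quotient.mk I f :=
        (map_mul _ _ _).trans (congrArg Subtype.val h)
      change π (Ideal.Quotient.mk I f) = 0
      rw [← h1, hπ, Ideal.Quotient.eq_zero_iff_mem]
      exact Ideal.mem_sup_right (Ideal.mul_mem_right _ _ (Ideal.mem_span_singleton_self l))
  refine ⟨Module.finrank K (LinearMap.range φ), ?_, LinearMap.finrank_range_le φ, fun hinj => ?_⟩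
  · rw [hilbertFunction, hilbertFunction, ← hrange, ← hker]
    exact LinearMap.finrank_range_add_finrank_ker ψ
  · refine LinearMap.finrank_range_of_inj ((injective_iff_map_eq_zero φ).2 ?_)
    rintro ⟨a, ha⟩ h
    obtain ⟨f, hf, rfl⟩ := mem_gradedPiece.1 ha
    have h1 : Ideal.Quotient.mk I (l * f) = 0 := (map_mul _ _ _).trans (congrArg Subtype.val h)
    exact Subtype.ext (Ideal.Quotient.eq_zero_iff_mem.2
      (hinj f hf (Ideal.Quotient.eq_zero_iff_mem.1 h1)))

/-- The multiplications by `l` have maximal rank in all degrees `d ≥ 0`. -/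
def HasMaximalRank (I : Ideal (MvPolynomial (Fin n) K)) (l : MvPolynomial (Fin n) K) : Prop :=
  ∀ d : ℕ, (∀ f : MvPolynomial (Fin n) K, f.IsHomogeneous d → l * f ∈ I → f ∈ I) ∨
    ∀ g : MvPolynomial (Fin n) K, g.IsHomogeneous (d + 1) →
      ∃ f : MvPolynomial (Fin n) K, f.IsHomogeneous d ∧ l * f - g ∈ I

theorem hilbertFunction_sup_eq_zero {d : ℕ}
    (h : ∀ g : MvPolynomial (Fin n) K, g.IsHomogeneous (d + 1) →
      ∃ f : MvPolynomial (Fin n) K, f.IsHomogeneous d ∧ l * f - g ∈ I) :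
    hilbertFunction (I ⊔ Ideal.span {l}) (d + 1) = 0 := by
  refine hilbertFunction_eq_zero_iff.2 fun g hg => ?_
  obtain ⟨f, -, hfg⟩ := h g hg
  have h1 : l * f ∈ I ⊔ Ideal.span {l} :=
    Ideal.mem_sup_right (Ideal.mul_mem_right _ _ (Ideal.mem_span_singleton_self l))
  simpa using sub_mem h1 (Ideal.mem_sup_left hfg)

theorem HasMaximalRank.hilbertFunction_sup (hr : HasMaximalRank I l) (hI : IsHomogIdeal I)
    (hI' : I ≠ ⊤) (hl : l.IsHomogeneous 1) :
    hilbertFunction (I ⊔ Ideal.span {l}) = deltaSeq (hilbertFunction I) := by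
  funext d
  cases d with
  | zero =>
    rw [deltaSeq, hilbertFunction_zero hI',
      hilbertFunction_zero (sup_span_singleton_ne_top hI hI' hl)]
  | succ d =>
    rw [deltaSeq]
    obtain ⟨r, h1, h2, h3⟩ := exists_rank_mul hI hl d
    rcases hr d with h | h
    · have := h3 h
      omega
    · have := hilbertFunction_sup_eq_zero h
      omega

/-- Let `k` be the first degree in which `A / l` vanishes in degree `k + 1`. Before `k` the
multiplication by `l` is injective and not surjective, and from `k` on it is surjective. -/
theorem HasMaximalRank.isUnimodalSeq (hr : HasMaximalRank I l) (hI : IsHomogIdeal I)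
    (hl : l.IsHomogeneous 1) (hfin : ∃ s, ∀ d, s < d → hilbertFunction I d = 0) :
    IsUnimodalSeq (hilbertFunction I) := by
  classical
  have hex : ∃ k, hilbertFunction (I ⊔ Ideal.span {l}) (k + 1) = 0 := by
    obtain ⟨s, hs⟩ := hfin
    obtain ⟨r, h1, -⟩ := exists_rank_mul hI hl s
    exact ⟨s, by have := hs (s + 1) (by omega); omega⟩
  refine ⟨Nat.find hex, fun i hi => ?_, fun i hi => ?_⟩
  · have hne := Nat.find_min hex hi
    obtain ⟨r, h1, -, h3⟩ := exists_rank_mul hI hl i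
    rcases hr i with h | h
    · have := h3 h
      omega
    · exact absurd (hilbertFunction_sup_eq_zero h) hne
  · obtain ⟨r, h1, h2, -⟩ := exists_rank_mul hI hl i
    have : hilbertFunction (I ⊔ Ideal.span {l}) (i + 1) = 0 :=
      hilbertFunction_eq_zero_of_le (Nat.find_spec hex) (Nat.succ_le_succ hi)
    omega

theorem HasMaximalRank.isWeakLefschetzOSequence_succ {m : ℕ} (hr : HasMaximalRank I l)
    (hI : IsHomogIdeal I) (hI' : I ≠ ⊤) (hl : l.IsHomogeneous 1)
    (hfin : ∃ s, ∀ d, s < d → hilbertFunction I d = 0)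
    (h : IsWeakLefschetzOSequence K m (hilbertFunction (I ⊔ Ideal.span {l}))) :
    IsWeakLefschetzOSequence K (m + 1) (hilbertFunction I) :=
  ⟨⟨⟨n, I, hI, hI', fun _ => rfl⟩, hfin⟩, hr.isUnimodalSeq hI hl hfin,
    hr.hilbertFunction_sup hI hI' hl ▸ h⟩

theorem injective_mul_of_notMem (hl : l ∉ I) (f : MvPolynomial (Fin n) K)
    (hf : f.IsHomogeneous 0) (hlf : l * f ∈ I) : f ∈ I := by
  obtain ⟨c, rfl⟩ : ∃ c, f = C c :=
    ⟨coeff 0 f, by rw [← homogeneousComponent_zero, homogeneousComponent_eq_self hf]⟩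
  by_cases hc : c = 0
  · rw [hc, map_zero]
    exact zero_mem _
  · refine absurd ?_ hl
    have h2 := I.mul_mem_right (C c⁻¹) hlf
    rwa [mul_assoc, ← C_mul, mul_inv_cancel₀ hc, C_1, mul_one] at h2

/-- If `A` vanishes in degree two, then any linear form that is nonzero in `A` has maximal rank,
and also the zero form if `A` vanishes in degree one. -/
theorem isWeakLefschetzOSequence_of_hilbertFunction_two_eq_zero (m : ℕ)
    {I : Ideal (MvPolynomial (Fin n) K)} (hI : IsHomogIdeal I) (hI' : I ≠ ⊤)
    (h2 : hilbertFunction I 2 = 0) : IsWeakLefschetzOSequence K m (hilbertFunction I) := by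
  have hfin : ∃ s, ∀ d, s < d → hilbertFunction I d = 0 :=
    ⟨1, fun d hd => hilbertFunction_eq_zero_of_le h2 hd⟩
  induction m generalizing I with
  | zero => exact ⟨⟨n, I, hI, hI', fun _ => rfl⟩, hfin⟩
  | succ m ih =>
    have hsurj : ∀ l : MvPolynomial (Fin n) K, ∀ d, hilbertFunction I (d + 1) = 0 →
        ∀ g : MvPolynomial (Fin n) K, g.IsHomogeneous (d + 1) →
        ∃ f : MvPolynomial (Fin n) K, f.IsHomogeneous d ∧ l * f - g ∈ I := fun l d hd g hg =>
      ⟨0, isHomogeneous_zero _ _ _, by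
        rw [mul_zero, zero_sub, neg_mem_iff]
        exact hilbertFunction_eq_zero_iff.1 hd g hg⟩
    obtain ⟨l, hl, hr⟩ : ∃ l : MvPolynomial (Fin n) K, l.IsHomogeneous 1 ∧ HasMaximalRank I l := by
      by_cases h1 : hilbertFunction I 1 = 0
      · exact ⟨0, isHomogeneous_zero _ _ _, fun d =>
          Or.inr (hsurj 0 d (hilbertFunction_eq_zero_of_le h1 (by omega)))⟩
      · rw [hilbertFunction_eq_zero_iff] at h1
        push Not at h1
        obtain ⟨l, hl, hlI⟩ := h1
        refine ⟨l, hl, fun d => ?_⟩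
        cases d with
        | zero => exact Or.inl (injective_mul_of_notMem hlI)
        | succ d => exact Or.inr (hsurj l _ (hilbertFunction_eq_zero_of_le h2 (by omega)))
    have h2' : hilbertFunction (I ⊔ Ideal.span {l}) 2 = 0 :=
      hilbertFunction_eq_zero_iff.2 fun f hf =>
        Ideal.mem_sup_left (hilbertFunction_eq_zero_iff.1 h2 f hf)
    exact hr.isWeakLefschetzOSequence_succ hI hI' hl hfin
      (ih (isHomogIdeal_sup_span_singleton hI hl) (sup_span_singleton_ne_top hI hI' hl) h2'
        ⟨1, fun d hd => hilbertFunction_eq_zero_of_le h2' hd⟩)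

theorem isWeakLefschetzOSequence_of_hasWLPTimes {m : ℕ} {I : Ideal (MvPolynomial (Fin n) K)}
    (hI : IsHomogIdeal I) (hI' : I ≠ ⊤) (hfin : ∃ s, ∀ d, s < d → hilbertFunction I d = 0)
    (hw : HasWLPTimes m I) : IsWeakLefschetzOSequence K m (hilbertFunction I) := by
  induction m generalizing I with
  | zero => exact ⟨⟨n, I, hI, hI', fun _ => rfl⟩, hfin⟩
  | succ m ih =>
    obtain ⟨L, hL⟩ := hw
    have h0 := hL 0
    have hempty : {f | ∃ j < (0 : Fin (m + 1)), f = L j} = ∅ := by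
      ext f
      simp
    rw [hempty, Ideal.span_empty, sup_bot_eq, isWeakLefschetzElement_iff] at h0
    obtain ⟨hl, hd⟩ := h0
    by_cases hlI : L 0 ∈ I
    · -- multiplication by zero has maximal rank in degree one only if `A` vanishes in degree two
      refine isWeakLefschetzOSequence_of_hilbertFunction_two_eq_zero _ hI hI' ?_
      rcases hd 1 le_rfl with h | h
      · exact hilbertFunction_eq_zero_of_le (d := 1)
          (hilbertFunction_eq_zero_iff.2 fun f hf => h f hf (Ideal.mul_mem_right _ _ hlI)) (by omega)
      · refine hilbertFunction_eq_zero_iff.2 fun g hg => ?_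
        obtain ⟨f, -, hfg⟩ := h g hg
        simpa using sub_mem (Ideal.mul_mem_right f I hlI) hfg
    · have hr : HasMaximalRank I (L 0) := fun d => by
        cases d with
        | zero => exact Or.inl (injective_mul_of_notMem hlI)
        | succ d => exact hd _ (by omega)
      refine hr.isWeakLefschetzOSequence_succ hI hI' hl hfin
        (ih (isHomogIdeal_sup_span_singleton hI hl) (sup_span_singleton_ne_top hI hI' hl) ?_ ?_)
      · obtain ⟨s, hs⟩ := hfin
        exact ⟨s, fun d hd => hilbertFunction_eq_zero_iff.2 fun f hf =>
          Ideal.mem_sup_left (hilbertFunction_eq_zero_iff.1 (hs d hd) f hf)⟩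
      · refine ⟨fun i => L i.succ, fun i => ?_⟩
        have h1 : I ⊔ Ideal.span {L 0} ⊔ Ideal.span {f | ∃ j < i, f = L j.succ} =
            I ⊔ Ideal.span {f | ∃ j < i.succ, f = L j} := by
          rw [sup_assoc, ← Ideal.span_union]
          congr 2
          ext f
          rw [Set.mem_union, Set.mem_singleton_iff, Set.mem_ofPred_eq, Set.mem_ofPred_eq,
            Fin.exists_fin_succ]
          simp [Fin.succ_pos]
        rw [h1]
        exact hL i.succ

end

theorem proposition3p2 (K : Type*) [Field K] [CharZero K] (m : ℕ) :
    (∀ h : ℕ → ℕ, IsWeakLefschetzOSequence K m h →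
      IsStronglyStable (lefschetzIdeal K m h) ∧
      (∀ d, hilbertFunction (lefschetzIdeal K m h) d = h d) ∧
      IsArtinianRing (MvPolynomial (Fin (h 1)) K ⧸ lefschetzIdeal K m h) ∧
      HasWLPTimes m (lefschetzIdeal K m h)) ∧
    (∀ h : ℕ → ℕ, IsWeakLefschetzOSequence K m h ↔
      ∃ (n : ℕ) (I : Ideal (MvPolynomial (Fin n) K)),
        IsHomogIdeal I ∧ I ≠ ⊤ ∧ IsArtinianRing (MvPolynomial (Fin n) K ⧸ I) ∧
        HasWLPTimes m I ∧ ∀ d, hilbertFunction I d = h d) := by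
  have key : ∀ h : ℕ → ℕ, IsWeakLefschetzOSequence K m h →
      IsStronglyStable (lefschetzIdeal K m h) ∧
      (∀ d, hilbertFunction (lefschetzIdeal K m h) d = h d) ∧
      IsArtinianRing (MvPolynomial (Fin (h 1)) K ⧸ lefschetzIdeal K m h) ∧
      HasWLPTimes m (lefschetzIdeal K m h) := fun h hh => by
    obtain ⟨hst, hhilb, hwlp⟩ := lefschetzIdealAux_spec m (h 1) h hh rfl
    obtain ⟨s, hs⟩ := hh.isFiniteOSequence.2
    exact ⟨hst, hhilb, isArtinianRing_of_hilbertFunction_eq_zero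
      ⟨s, fun d hd => (hhilb d).trans (hs d hd)⟩, hwlp⟩
  refine ⟨key, fun h => ⟨fun hh => ?_, ?_⟩⟩
  · obtain ⟨hst, hhilb, hart, hwlp⟩ := key h hh
    refine ⟨h 1, lefschetzIdeal K m h, ?_, fun htop => ?_, hart, hwlp, hhilb⟩
    · obtain ⟨⟨S, hS⟩, -⟩ := hst
      rw [hS]
      exact isHomogIdeal_monomialIdeal S
    · have h0 := hhilb 0
      rw [hh.isFiniteOSequence.1.apply_zero, htop,
        hilbertFunction_eq_zero_iff.2 fun f _ => Submodule.mem_top] at h0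
      exact zero_ne_one h0
  · rintro ⟨n, I, hI, hI', hart, hwlp, hhilb⟩
    rw [← funext hhilb]
    exact isWeakLefschetzOSequence_of_hasWLPTimes hI hI' (exists_hilbertFunction_eq_zero hI) hwlp
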